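/- Let $N>2$ and $R=\mathbb F_2[V_0,V_{N+1}]$. Let $\mathcal A_0$ be the associative $R$-algebra generated by $I_i,U_i,s_i$ ($i\in\mathbb Z/N$), where the $I_i$ are orthogonal idempotents with sum $1$, $U_i=I_iU_iI_i$, $s_i=I_is_iI_{i+1}$, with relations $U_is_j=s_jU_i=0$ for all $i,j$. Let $\mathcal B_0$ be the associative $R$-algebra generated by $I_i,\rho_i,\sigma_i$ ($i\in\mathbb Z/N$), where the $I_i$ are orthogonal idempotents with sum $1$, $\rho_i=I_i\rho_iI_i$, $\sigma_i=I_i\sigma_iI_{i+1}$, with relations $\rho_i\rho_j=0=\sigma_i\sigma_j$ for all $i,j$. Both are free $R$-modules on the nonzero monomials in these generators ($V_0$ and $V_{N+1}$ not being counted among them). Both algebras carry a multiplicative Alexander grading in $\mathbb Z^{2N}=\langle h_1,\dots,h_{2N}\rangle$ and a multiplicative Maslov grading $m$ in $\mathbb Z$. The Alexander grading is $A(I_i)=0$, $A(U_i)=A(\rho_i)=h_{2i-1}$, $A(s_i)=A(\sigma_i)=h_{2i}$ $(1\le i\le N)$, $A(V_0)=\sum_{k=1}^{2N}h_k$, $A(V_{N+1})=\sum_{k=1}^Nh_{2k}$.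 The Maslov grading is $m(I_i)=m(U_i)=m(s_i)=0$, $m(\rho_i)=m(\sigma_i)=-1$, $m(V_0)=2N-2$, and $m(V_{N+1})=2$ in $\mathcal A_0$, $m(V_{N+1})=-2$ in $\mathcal B_0$. For $A\in\{\mathcal A_0,\mathcal B_0\}$ let $A_+$ be the ideal spanned over $R$ by the monomials other than the $I_i$. Let $C^n(A)$ be the $R$-module of $R$-multilinear maps $f\colon A_+^{\,n}\to A$ such that, for monomials $a_1,\dots,a_n\in A_+$ and $a_0=I_k$, $a_{n+1}=I_l$, one has $a_0f(a_1,\dots,a_n)a_{n+1}=0$ unless the final idempotent of $a_{i-1}$ equals the initial idempotent of $a_i$ for every $1\le i\le n+1$. The differential is $$(\delta f)(a_0,\dots,a_n)=a_0f(a_1,\dots,a_n)+\sum_{i=0}^{n-1}f(a_0,\dots,a_ia_{i+1},\dots,a_n)+f(a_0,\dots,a_{n-1})a_n .$$ Let $C^{n,j}(A)\subseteq C^n(A)$ be the $R$-submodule generated by the cochains $f$ that preserve the Alexander grading and satisfy $m(f(a_1,\dots,a_n))=\sum_{i=1}^n m(a_i)+n+j$ for homogeneous $a_1,\dots,a_n$.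 Then $\delta$ maps $C^{n,j}(A)$ to $C^{n+1,j-1}(A)$; let $H^{n,j}(A)$ be the cohomology at $C^{n,j}(A)$ (with $C^{-1,j}=0$), an $R$-module. Then, as $R$-modules, $$H^{n,-2}(\mathcal A_0)\cong\begin{cases}R& n=2N\\0&\text{otherwise}\end{cases}\qquad\text{and}\qquad H^{n,-1}(\mathcal A_0)=0\ \text{ for all } n\ge 2,$$ $$H^{n,-2}(\mathcal B_0)\cong\begin{cases}R& n=N\\0&\text{otherwise}\end{cases}\qquad\text{and}\qquad H^{n,-1}(\mathcal B_0)=0\ \text{ for all } n\neq 1 .$$ -/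

import Mathlib

namespace StarAlg

/-- The ground ring `R = 𝔽₂[V₀, V_{N+1}]`; the variable `0` is `V₀` and the variable `1` is
`V_{N+1}`. -/
abbrev R : Type := MvPolynomial (Fin 2) (ZMod 2)

/-- The two kinds of generators besides the idempotents. In `A₀`, `loop` at `i` is `U_i` and `step`
at `i` is `s_i`; in `B₀`, `loop` at `i` is `ρ_i` and `step` at `i` is `σ_i`. -/
inductive Letter : Type
  | loop
  | step

/-- The final idempotent of a generator with initial idempotent `i`. -/
def Letter.next {N : ℕ} (i : ZMod N) : Letter → ZMod N
  | .loop => i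
  | .step => i + 1

/-- A nonzero monomial in the generators: an initial idempotent and a word of generators, each
starting where the previous one ends. `r x y` says that a generator of kind `x` followed by the
composable generator of kind `y` has nonzero product. The empty word at `i` is the idempotent
`I_i`. -/
@[ext]
structure Path (N : ℕ) (r : Letter → Letter → Prop) : Type where
  start : ZMod N
  word : List Letter
  chain : word.IsChain r

namespace Path

variable {N : ℕ} {r : Letter → Letter → Prop}

/-- The final idempotent of a monomial. -/
def target (p : Path N r) : ZMod N := p.word.foldl Letter.next p.start

open Classical in
/-- Concatenation of monomials; `none` means that the product is zero. -/
noncomputable def comp (p q : Path N r) : Option (Path N r) :=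
  if h : p.target = q.start ∧ (p.word ++ q.word).IsChain r then
    some ⟨p.start, p.word ++ q.word, h.2⟩
  else none

/-- The monomial `I_i`. -/
def idem (i : ZMod N) : Path N r := ⟨i, [], List.isChain_nil⟩

theorem comp_eq_some {p q c : Path N r} :
    p.comp q = some c ↔
      p.target = q.start ∧ c.start = p.start ∧ c.word = p.word ++ q.word := by
  unfold comp
  split_ifs with h
  · simp only [Option.some.injEq]
    constructor
    · rintro rfl
      exact ⟨h.1, rfl, rfl⟩
    · rintro ⟨_, h2, h3⟩
      exact Path.ext h2.symm h3.symm
  · simp only [false_iff]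
    rintro ⟨h1, _, h3⟩
    exact h ⟨h1, h3 ▸ c.chain⟩

theorem comp_assoc (p q s : Path N r) :
    (p.comp q).bind (fun c => c.comp s) = (q.comp s).bind (fun c => p.comp c) := by
  ext d
  simp only [Option.bind_eq_some_iff, comp_eq_some]
  constructor
  · rintro ⟨c, ⟨h1, h2, h3⟩, h4, h5, h6⟩
    have hch : (q.word ++ s.word).IsChain r := by
      have := d.chain
      rw [h6, h3, List.append_assoc] at this
      exact this.right_of_append
    refine ⟨⟨q.start, q.word ++ s.word, hch⟩, ⟨?_, rfl, rfl⟩, h1, h5.trans h2, ?_⟩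
    · rw [← h4]
      simp only [target, h2, h3, List.foldl_append]
      exact congrArg (fun i => List.foldl Letter.next i q.word) h1.symm
    · rw [h6, h3, List.append_assoc]
  · rintro ⟨c, ⟨h1, h2, h3⟩, h4, h5, h6⟩
    have hch : (p.word ++ q.word).IsChain r := by
      have := d.chain
      rw [h6, h3, ← List.append_assoc] at this
      exact this.left_of_append
    refine ⟨⟨p.start, p.word ++ q.word, hch⟩, ⟨h4.trans h2, rfl, rfl⟩, ?_, h5, ?_⟩
    · rw [← h1]
      simp only [target, List.foldl_append]
      exact congrArg (fun i => List.foldl Letter.next i q.word) (h4.trans h2)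
    · rw [h6, h3, List.append_assoc]

end Path

/-- The `R`-algebra with `R`-basis the monomials of `Path N r`. -/
def Alg (N : ℕ) (r : Letter → Letter → Prop) : Type := Path N r →₀ R

namespace Alg

variable {N : ℕ} {r : Letter → Letter → Prop}

noncomputable instance : AddCommGroup (Alg N r) := inferInstanceAs (AddCommGroup (Path N r →₀ R))

noncomputable instance : Module R (Alg N r) := inferInstanceAs (Module R (Path N r →₀ R))

/-- The monomials form an `R`-basis. -/
noncomputable def basis : Module.Basis (Path N r) R (Alg N r) :=
  Module.Basis.ofRepr (LinearEquiv.refl R (Path N r →₀ R))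

/-- The idempotent `I_i`. -/
noncomputable def idem (i : ZMod N) : Alg N r := basis (Path.idem i)

/-- The product of two monomials, with `none` read as zero. -/
noncomputable def ofOption : Option (Path N r) → Alg N r
  | some p => basis p
  | none => 0

/-- The multiplication: the bilinear extension of the concatenation of monomials. -/
noncomputable def mulLin : Alg N r →ₗ[R] Alg N r →ₗ[R] Alg N r :=
  basis.constr R fun p => basis.constr R fun q => ofOption (p.comp q)

noncomputable instance : Mul (Alg N r) := ⟨fun a b => mulLin a b⟩

theorem mul_def (a b : Alg N r) : a * b = mulLin a b := rfl

theorem basis_mul_basis (p q : Path N r) :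
    (basis p * basis q : Alg N r) = ofOption (p.comp q) := by
  rw [mul_def, mulLin, Module.Basis.constr_basis, Module.Basis.constr_basis]

theorem mul_assoc' (a b c : Alg N r) : a * b * c = a * (b * c) := by
  have key : (mulLin (N := N) (r := r)).compr₂ mulLin =
      ((LinearMap.llcomp R (Alg N r) (Alg N r) (Alg N r)).comp mulLin).compl₁₂
        LinearMap.id mulLin := by
    refine basis.ext fun p => basis.ext fun q => basis.ext fun s => ?_
    change (basis p * basis q) * basis s = basis p * (basis q * basis s)
    rw [basis_mul_basis, basis_mul_basis]
    have h1 : ∀ o : Option (Path N r),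
        ofOption o * basis s = ofOption (o.bind fun c => c.comp s) := by
      rintro (_ | c)
      · change mulLin 0 (basis s) = 0
        rw [map_zero, LinearMap.zero_apply]
      · exact basis_mul_basis c s
    have h2 : ∀ o : Option (Path N r),
        basis p * ofOption o = ofOption (o.bind fun c => p.comp c) := by
      rintro (_ | c)
      · change mulLin (basis p) 0 = 0
        rw [map_zero]
      · exact basis_mul_basis p c
    rw [h1, h2, Path.comp_assoc]
  exact congrArg (fun f => f a b c) key

noncomputable instance : NonUnitalRing (Alg N r) where
  left_distrib a b c := by simp only [mul_def, map_add]
  right_distrib a b c := by simp only [mul_def, map_add, LinearMap.add_apply]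
  zero_mul a := by simp only [mul_def, map_zero, LinearMap.zero_apply]
  mul_zero a := by simp only [mul_def, map_zero]
  mul_assoc := mul_assoc'

instance : IsScalarTower R (Alg N r) (Alg N r) where
  smul_assoc x a b := by simp only [smul_eq_mul, mul_def, map_smul, LinearMap.smul_apply]

instance : SMulCommClass R (Alg N r) (Alg N r) where
  smul_comm x a b := by simp only [smul_eq_mul, mul_def, map_smul]

theorem repr_mul_idem (a b : Alg N r) (ha : ∀ i, basis.repr a (Path.idem i) = 0) (i : ZMod N) :
    basis.repr (a * b) (Path.idem i) = 0 := by
  have hb : ∀ p : Path N r, p.word ≠ [] → ∀ b : Alg N r,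
      basis.repr (basis p * b) (Path.idem i) = 0 := by
    intro p hp b
    have : (basis.coord (Path.idem i)).comp (mulLin (basis p)) = 0 := by
      refine basis.ext fun q => ?_
      change basis.repr (basis p * basis q) (Path.idem i) = 0
      rw [basis_mul_basis]
      rcases h : p.comp q with _ | c
      · simp only [ofOption, map_zero, Finsupp.coe_zero, Pi.zero_apply]
      · rw [ofOption, Module.Basis.repr_self]
        refine Finsupp.single_eq_of_ne fun hc => hp ?_
        have := (Path.comp_eq_some.1 h).2.2
        rw [← hc] at this
        exact (List.append_eq_nil_iff.1 this.symm).1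
    exact congrArg (fun f => f b) this
  have hab : a * b = (basis.repr a).sum fun p x => x • (basis p * b) := by
    conv_lhs => rw [← basis.linearCombination_repr a]
    rw [Finsupp.linearCombination_apply, mul_def, Finsupp.sum, map_sum, LinearMap.sum_apply]
    simp only [map_smul, LinearMap.smul_apply]
    rfl
  rw [hab, Finsupp.sum, map_sum, Finsupp.finsetSum_apply]
  refine Finset.sum_eq_zero fun p _ => ?_
  rw [map_smul, Finsupp.smul_apply]
  by_cases hp : p.word = []
  · have : p = Path.idem p.start := Path.ext rfl hp
    rw [this, ha, zero_smul]
  · rw [hb p hp, smul_zero]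

/-- The augmentation ideal `A₊`: the span of all monomials other than the idempotents. -/
noncomputable def plus (N : ℕ) (r : Letter → Letter → Prop) : NonUnitalSubalgebra R (Alg N r) where
  carrier := {a | ∀ i, basis.repr a (Path.idem i) = 0}
  add_mem' {a b} ha hb i := by
    rw [map_add, Finsupp.add_apply, ha, hb, add_zero]
  zero_mem' _ := by rw [map_zero, Finsupp.zero_apply]
  mul_mem' {a b} ha _ i := repr_mul_idem a b ha i
  smul_mem' x a ha i := by
    rw [map_smul, Finsupp.smul_apply, ha, smul_zero]

end Alg

/-- The Alexander grading group `H₀(S¹ ∖ {p₁, …, p_{2N}}; ℤ) ≅ ℤ^{2N}`. The generator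
`h_{2i-1}` is indexed by `(i, loop)` and `h_{2i}` by `(i, step)`. -/
abbrev AlexGroup (N : ℕ) : Type := ZMod N × Letter → ℤ

open Classical in
/-- The Alexander grading of the word `w` read from the idempotent `i`. -/
noncomputable def alexWord {N : ℕ} : ZMod N → List Letter → AlexGroup N
  | _, [] => 0
  | i, x :: w => Pi.single (i, x) 1 + alexWord (Letter.next i x) w

/-- The Alexander grading of `V₀ ^ e 0 * V_{N+1} ^ e 1`, where `A(V₀)` is the sum of all
generators and `A(V_{N+1})` is the sum of the `h_{2i}`. -/
def alexCoeff {N : ℕ} (e : Fin 2 →₀ ℕ) : AlexGroup N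
  | (_, .loop) => e 0
  | (_, .step) => e 0 + e 1

/-- The data of one of the two algebras: which composable generators have nonzero product, the
Maslov grading of the generators other than idempotents, and that of `V₀` and of `V_{N+1}`. -/
structure Datum : Type where
  rel : Letter → Letter → Prop
  mGen : ℤ
  mV : Fin 2 → ℤ

/-- `A₀`: the only nonzero products of two composable generators are `U_i U_i` and `s_i s_{i+1}`;
`m(U_i) = m(s_i) = 0`, `m(V₀) = 2N - 2`, `m(V_{N+1}) = 2`. -/
def datumA (N : ℕ) : Datum := ⟨fun x y => x = y, 0, ![2 * (N : ℤ) - 2, 2]⟩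

/-- `B₀`: the only nonzero products of two composable generators are `ρ_i σ_i` and
`σ_i ρ_{i+1}`; `m(ρ_i) = m(σ_i) = -1`, `m(V₀) = 2N - 2`, `m(V_{N+1}) = -2`. -/
def datumB (N : ℕ) : Datum := ⟨fun x y => x ≠ y, -1, ![2 * (N : ℤ) - 2, -2]⟩

section Hochschild

variable (N : ℕ) (D : Datum)

/-- The underlying associative `R`-algebra. -/
abbrev Datum.A : Type := Alg N D.rel

/-- The augmentation ideal. -/
abbrev Datum.APlus : Type := Alg.plus N D.rel

/-- `a` is homogeneous of Alexander grading `α` and Maslov grading `μ`: so is every term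
`V₀ ^ e 0 * V_{N+1} ^ e 1 * p` of `a`. -/
def Datum.IsHomogeneous {N : ℕ} (D : Datum) (α : AlexGroup N) (μ : ℤ) (a : D.A N) : Prop :=
  ∀ (p : Path N D.rel) (e : Fin 2 →₀ ℕ), e ∈ (Alg.basis.repr a p).support →
    alexCoeff e + alexWord p.start p.word = α ∧
      e 0 * D.mV 0 + e 1 * D.mV 1 + p.word.length * D.mGen = μ

/-- The `n`-cochains `Cⁿ`: the `R`-multilinear maps `f : A₊ⁿ → A`, that is, the bimodule maps
`a₀ ⊗ ⋯ ⊗ a_{n+1} ↦ a₀ f(a₁, …, aₙ) a_{n+1}`, that vanish on `a₀ ⊗ ⋯ ⊗ a_{n+1}` unless the final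
idempotent of `a_{i-1}` is the initial idempotent of `a_i` for all `1 ≤ i ≤ n + 1`. Here `u` lists
the initial and `w` the final idempotents of `a₁, …, aₙ`, while `a₀ = I_k` and
`a_{n+1} = I_l`. -/
noncomputable def Datum.cochains (n : ℕ) : Submodule R ((Fin n → D.APlus N) → D.A N) where
  carrier := {f | (∃ F : MultilinearMap R (fun _ : Fin n => D.APlus N) (D.A N), ⇑F = f) ∧
    ∀ (a : Fin n → D.APlus N) (u w : Fin n → ZMod N),
      (∀ i, Alg.idem (u i) * (a i : D.A N) = (a i : D.A N) ∧
        (a i : D.A N) * Alg.idem (w i) = (a i : D.A N)) →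
      ∀ k l : ZMod N,
        (Fin.cons k w : Fin (n + 1) → ZMod N) ≠ (Fin.snoc u l : Fin (n + 1) → ZMod N) →
        Alg.idem k * f a * Alg.idem l = 0}
  add_mem' := by
    rintro f g ⟨⟨F, rfl⟩, hf⟩ ⟨⟨G, rfl⟩, hg⟩
    refine ⟨⟨F + G, rfl⟩, fun a u w h k l hkl => ?_⟩
    rw [Pi.add_apply, mul_add, add_mul, hf a u w h k l hkl, hg a u w h k l hkl, add_zero]
  zero_mem' := ⟨⟨0, rfl⟩, fun a u w _ k l _ => by rw [Pi.zero_apply, mul_zero, zero_mul]⟩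
  smul_mem' := by
    rintro x f ⟨⟨F, rfl⟩, hf⟩
    refine ⟨⟨x • F, rfl⟩, fun a u w h k l hkl => ?_⟩
    rw [Pi.smul_apply, mul_smul_comm, smul_mul_assoc, hf a u w h k l hkl, smul_zero]

/-- The Hochschild differential
`(δf)(a₀, …, aₙ) = a₀ f(a₁, …, aₙ) + ∑_{i<n} f(…, aᵢ aᵢ₊₁, …) + f(a₀, …, aₙ₋₁) aₙ`
(the signs are immaterial in characteristic 2). -/
noncomputable def Datum.diff (n : ℕ) :
    ((Fin n → D.APlus N) → D.A N) →ₗ[R] ((Fin (n + 1) → D.APlus N) → D.A N) where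
  toFun f a := (a 0 : D.A N) * f (fun i => a i.succ)
    + ∑ i : Fin n, f (Fin.contractNth i.castSucc (fun x y => x * y) a)
    + f (fun i => a i.castSucc) * (a (Fin.last n) : D.A N)
  map_add' f g := by
    funext a
    simp only [Pi.add_apply, mul_add, add_mul, Finset.sum_add_distrib]
    abel
  map_smul' x f := by
    funext a
    simp only [Pi.smul_apply, RingHom.id_apply, mul_smul_comm, smul_mul_assoc, smul_add,
      Finset.smul_sum]

/-- The cochains in `Cⁿ` that preserve the Alexander grading and are of Maslov grading `j`:
`m(f(a₁, …, aₙ)) = m(a₁) + ⋯ + m(aₙ) + n + j` for homogeneous `a₁, …, aₙ`. -/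
def Datum.homogeneousCochains (n : ℕ) (j : ℤ) : Set ((Fin n → D.APlus N) → D.A N) :=
  {f | f ∈ D.cochains N n ∧
    ∀ (a : Fin n → D.APlus N) (α : Fin n → AlexGroup N) (μ : Fin n → ℤ),
      (∀ i, D.IsHomogeneous (α i) (μ i) (a i : D.A N)) →
      D.IsHomogeneous (∑ i, α i) (∑ i, μ i + n + j) (f a)}

/-- `C^{n,j}`: the `R`-module generated by the homogeneous cochains of bigrading `(n, j)`. (The
homogeneous cochains alone are only an `𝔽₂`-space, as `V₀` and `V_{N+1}` have nonzero gradings.) -/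
noncomputable def Datum.bicochains (n : ℕ) (j : ℤ) : Submodule R ((Fin n → D.APlus N) → D.A N) :=
  Submodule.span R (D.homogeneousCochains N n j)

/-- The cocycles of bigrading `(n, j)`. -/
noncomputable def Datum.cocycles (n : ℕ) (j : ℤ) :
    Submodule R ((Fin n → D.APlus N) → D.A N) :=
  D.bicochains N n j ⊓ LinearMap.ker (D.diff N n)

/-- The coboundaries of bigrading `(n, j)`; the differential maps `C^{n,j+1}` to `C^{n+1,j}`. -/
noncomputable def Datum.coboundaries :
    (n : ℕ) → (j : ℤ) → Submodule R ((Fin n → D.APlus N) → D.A N)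
  | 0, _ => ⊥
  | n + 1, j => (D.bicochains N n (j + 1)).map (D.diff N n)

/-- The bigraded unital Hochschild cohomology `H^{n,j}`, an `R`-module. -/
abbrev Datum.H (n : ℕ) (j : ℤ) : Type :=
  D.cocycles N n j ⧸ (D.coboundaries N n j).submoduleOf (D.cocycles N n j)

end Hochschild

end StarAlg

/-! Both algebras are path algebras modulo quadratic monomial relations, hence Koszul, and their
Hochschild cohomology is controlled by the values of cochains on reduced lists: sequences of single
generators with vanishing consecutive products.

To see this, the bar lists are matched as in discrete Morse theory. `QuadSystem.split` cuts the
first letter off the first entry that is not a letter, provided the entries before it are letters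
and the consecutive products up to that entry vanish. Every list is reduced, can be cut, or is the
result of a cut. On cochains vanishing on the results of cuts, the inner part of the differential
inverts the cut (`mergeSum_split`), while the two outer terms only involve lists with fewer letters.
Recursion on the number of letters thus yields a homotopy, and `barDiff_homotopy` shows that a
cocycle vanishing on reduced lists is a coboundary. The homotopy respects the Alexander and Maslov
gradings.

The gradings then leave almost nothing. Let a term `V₀^x V_{N+1}^y q` occur in the value on a
reduced composable list of length `n`, and count loops and steps in the list (`a`, `b`) and in `q`
(`a'`, `b'`). The Alexander grading gives `Nx + a' = a` and `N(x+y) + b' = b`. For `A₀` the list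
alternates between loops and steps and `q` is constant; with the Maslov grading, `2x + (N-2)y + a' +
b' = -j`. For `B₀` the list is constant and `q` alternates, so `x = 0` and `2y + a' + b' = -j`. If
`j = -1`, only `n = 1` remains. If `j = -2`, only `V₀ I_i` on the cyclic words through all `2N`
generators remains, respectively `V_{N+1} I_i` on the cyclic words in the `N` generators `σ_i`
(`datumA_adm`, `datumB_adm`).

In the surviving degree, the cocycle condition on a cyclic word prolonged by one letter identifies
the values on neighbouring rotations, so one value determines the class; no coboundary interferes,
because cochains one degree lower vanish on reduced lists. Conversely, the cochain taking the same
coefficient on all rotations has a differential vanishing on reduced lists, and the homotopy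
corrects it to a cocycle (`exists_cocycle`). This gives rank one (`nonempty_H_equiv`). -/

namespace StarAlg

/-- A set of monomials with a partial, associative product, in which every element that is not a
letter factors uniquely as a letter times a monomial, and in which the product `p * q` is nonzero
as soon as the product of `p` with a left factor of `q` is. -/
structure QuadSystem (X : Type*) where
  mul : X → X → Option X
  fac : X → Option (X × X)
  size : X → ℕ
  mul_assoc : ∀ p q s, (mul p q).bind (fun c => mul c s) = (mul q s).bind (fun c => mul p c)
  fac_eq_some : ∀ p x q, fac p = some (x, q) ↔ fac x = none ∧ mul x q = some p
  mul_front : ∀ p q s c, mul q s = some c → (mul p q = none ↔ mul p c = none)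
  size_pos : ∀ p, 0 < size p
  size_mul : ∀ p q c, mul p q = some c → size c = size p + size q

namespace QuadSystem

variable {X : Type*} (S : QuadSystem X)

/-! ### The Hochschild differential on functions of lists of monomials. -/

section Diff

variable {A : Type*} [NonUnitalRing A]

/-- The sum of the values of `F` on all lists obtained by multiplying two neighbours. -/
def mergeSum : (List X → A) → List X → A
  | _, [] => 0
  | _, [_] => 0
  | F, p :: q :: l =>
    (S.mul p q).elim 0 (fun c => F (c :: l)) + mergeSum (fun l' => F (p :: l')) (q :: l)

/-- Split off the first entry and multiply by it on the left. -/
def leftMul (β : X → A) (F : List X → A) : List X → A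
  | [] => 0
  | p :: l => β p * F l

/-- Split off the last entry and multiply by it on the right. -/
def rightMul (β : X → A) (F : List X → A) (l : List X) : A :=
  l.getLast?.elim 0 fun q => F l.dropLast * β q

/-- The two outer terms of the Hochschild differential. -/
def outer (β : X → A) (F : List X → A) (l : List X) : A := leftMul β F l + rightMul β F l

/-- The Hochschild differential on functions on lists of monomials. -/
def barDiff (β : X → A) (F : List X → A) (l : List X) : A := S.mergeSum F l + outer β F l

@[simp] theorem rightMul_nil (β : X → A) (F : List X → A) : rightMul β F [] = 0 := rfl

@[simp] theorem rightMul_concat (β : X → A) (F : List X → A) (l : List X) (q : X) :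
    rightMul β F (l ++ [q]) = F l * β q := by
  simp [rightMul]

theorem mergeSum_concat (F : List X → A) (l : List X) (p q : X) :
    S.mergeSum F (l ++ [p, q]) =
      S.mergeSum (fun l' => F (l' ++ [q])) (l ++ [p]) +
        (S.mul p q).elim 0 fun c => F (l ++ [c]) := by
  induction l generalizing F with
  | nil => simp [mergeSum]
  | cons a l ih =>
    rcases l with _ | ⟨b, l⟩
    · have := ih (fun l' => F (a :: l'))
      simp only [List.nil_append, List.cons_append] at this ⊢
      simp only [mergeSum, List.nil_append, List.cons_append] at this ⊢
      abel
    · have := ih (fun l' => F (a :: l'))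
      simp only [List.cons_append] at this ⊢
      rw [mergeSum, this, mergeSum, add_assoc]
      simp only [List.cons_append, List.append_assoc, List.nil_append]

theorem mergeSum_mul_left (a : A) (F : List X → A) (l : List X) :
    S.mergeSum (fun l' => a * F l') l = a * S.mergeSum F l := by
  induction l generalizing F with
  | nil => simp [mergeSum]
  | cons p l ih =>
    rcases l with _ | ⟨q, l⟩
    · simp [mergeSum]
    · rw [mergeSum, mergeSum, ih, mul_add]
      rcases S.mul p q with _ | c <;> simp

theorem mergeSum_mul_right (a : A) (F : List X → A) (l : List X) :
    S.mergeSum (fun l' => F l' * a) l = S.mergeSum F l * a := by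
  induction l generalizing F with
  | nil => simp [mergeSum]
  | cons p l ih =>
    rcases l with _ | ⟨q, l⟩
    · simp [mergeSum]
    · rw [mergeSum, mergeSum, ih (fun l' => F (p :: l')), add_mul]
      rcases S.mul p q with _ | c <;> simp

theorem mergeSum_add (F G : List X → A) (l : List X) :
    S.mergeSum (F + G) l = S.mergeSum F l + S.mergeSum G l := by
  induction l generalizing F G with
  | nil => simp [mergeSum]
  | cons p l ih =>
    rcases l with _ | ⟨q, l⟩
    · simp [mergeSum]
    · have := ih (fun l' => F (p :: l')) (fun l' => G (p :: l'))
      rw [mergeSum, mergeSum, mergeSum]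
      change _ + S.mergeSum ((fun l' => F (p :: l')) + (fun l' => G (p :: l'))) _ = _
      rw [this]
      rcases S.mul p q with _ | c
      · simp
      · simp only [Option.elim_some, Pi.add_apply]; abel

theorem mergeSum_congr (F G : List X → A) (q : X) (l : List X)
    (h : ∀ p l, F (p :: l) = G (p :: l)) : S.mergeSum F (q :: l) = S.mergeSum G (q :: l) := by
  induction l generalizing F G q with
  | nil => simp [mergeSum]
  | cons p l ih =>
    rw [mergeSum, mergeSum, ih _ (fun l' => G (q :: l')) _ fun _ _ => h _ _]
    rcases S.mul q p with _ | c <;> simp [h]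

theorem mergeSum_zero (l : List X) : S.mergeSum (0 : List X → A) l = 0 := by
  have := S.mergeSum_mul_left (0 : A) (0 : List X → A) l
  rwa [zero_mul, show (fun l' => (0 : A) * (0 : List X → A) l') = 0 from
    funext fun _ => zero_mul _] at this

theorem mergeSum_smul {K : Type*} [CommRing K] [Module K A] (x : K) (F : List X → A) (l : List X) :
    S.mergeSum (x • F) l = x • S.mergeSum F l := by
  induction l generalizing F with
  | nil => simp [mergeSum]
  | cons p l ih =>
    rcases l with _ | ⟨q, l⟩
    · simp [mergeSum]
    · rw [mergeSum, mergeSum]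
      change _ + S.mergeSum (x • fun l' => F (p :: l')) _ = _
      rw [ih, smul_add]
      rcases S.mul p q with _ | c <;> simp

/-- Multiply the first entry of the list on the left by `a`. -/
def headMul (F : List X → A) (a : X) : List X → A
  | [] => 0
  | p :: l => (S.mul a p).elim 0 fun c => F (c :: l)

/-- Merges at disjoint places occur in both orders and cancel in characteristic 2; merging three
neighbours in the two possible ways cancels by associativity. -/
theorem mergeSum_mergeSum (h2 : ∀ a : A, a + a = 0) (F : List X → A) (l : List X) :
    S.mergeSum (S.mergeSum F) l = 0 := by
  induction l generalizing F with
  | nil => simp [mergeSum]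
  | cons a l ih =>
    rcases l with _ | ⟨b, l⟩
    · simp [mergeSum]
    -- Merges of `a :: l'` either involve `a`, which gives `headMul`, or stay inside `l'`; the
    -- latter contribute a square that vanishes by induction.
    have h1 : S.mergeSum (fun l' => S.mergeSum F (a :: l')) (b :: l) =
        S.mergeSum (S.headMul F a) (b :: l) := by
      refine (S.mergeSum_congr (fun l' => S.mergeSum F (a :: l'))
        (S.headMul F a + S.mergeSum (fun l' => F (a :: l'))) _ _
        (fun p l => rfl)).trans ?_
      rw [mergeSum_add, ih, add_zero]
    rw [mergeSum, h1]
    rcases l with _ | ⟨c, l⟩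
    · rcases S.mul a b with _ | x <;> simp [mergeSum]
    have h3 : (S.mul b c).elim 0 (fun x => S.headMul F a (x :: l)) =
        (S.mul a b).elim 0 (fun x => (S.mul x c).elim 0 fun y => F (y :: l)) := by
      have := congrArg (fun o : Option X => o.elim 0 fun y => F (y :: l)) (S.mul_assoc a b c)
      rcases hx : S.mul a b with _ | x <;> rcases hy : S.mul b c with _ | y <;>
        simp only [hx, hy, Option.bind_none, Option.bind_some, Option.elim_none,
          Option.elim_some, headMul] at this ⊢ <;> exact this.symm
    have h4 : S.mergeSum (fun l' => S.headMul F a (b :: l')) (c :: l) =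
        (S.mul a b).elim 0 fun x => S.mergeSum (fun l' => F (x :: l')) (c :: l) := by
      rcases h : S.mul a b with _ | x
      · simp only [headMul, h, Option.elim_none]
        exact S.mergeSum_zero _
      · simp only [headMul, h, Option.elim_some]
    rw [show S.mergeSum (S.headMul F a) (b :: c :: l) = _ + _ from rfl, h3, h4]
    rcases S.mul a b with _ | x
    · simp
    · simp only [Option.elim_some, mergeSum]
      exact h2 _

/-- Besides the squared inner part, the expansion has terms with left factors only (`hL`), with
right factors only (`hR`) and with one of each (`hM`). The first two groups cancel by
multiplicativity of `β`, the third by associativity in `A`. -/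
theorem barDiff_barDiff (h2 : ∀ a : A, a + a = 0) (β : X → A)
    (hβ : ∀ p q, β p * β q = (S.mul p q).elim 0 β) (F : List X → A) :
    S.barDiff β (S.barDiff β F) = 0 := by
  funext l
  have hL : S.mergeSum (leftMul β F) l + leftMul β (S.mergeSum F) l
      + leftMul β (leftMul β F) l = 0 := by
    rcases l with _ | ⟨p, _ | ⟨q, l⟩⟩
    · simp [mergeSum, leftMul]
    · simp [mergeSum, leftMul]
    · have : (S.mul p q).elim 0 (fun c => leftMul β F (c :: l)) = β p * β q * F l := by
        rw [hβ]; rcases S.mul p q with _ | c <;> simp [leftMul]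
      rw [mergeSum, this]
      simp only [leftMul, mergeSum_mul_left]
      rw [_root_.mul_assoc]
      linear_combination (norm := abel) h2 (β p * (β q * F l)) + h2 (β p * S.mergeSum F (q :: l))
  have hR : S.mergeSum (rightMul β F) l + rightMul β (S.mergeSum F) l
      + rightMul β (rightMul β F) l = 0 := by
    rcases List.eq_nil_or_concat' l with rfl | ⟨l, q, rfl⟩
    · simp [mergeSum]
    rcases List.eq_nil_or_concat' l with rfl | ⟨l, p, rfl⟩
    · have : S.mergeSum F ([] : List X) = 0 := rfl
      rw [rightMul_concat, rightMul_concat, this]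
      simp [mergeSum]
    · have h1 : (S.mul p q).elim 0 (fun c => rightMul β F (l ++ [c])) = F l * (β p * β q) := by
        rw [hβ]; rcases S.mul p q with _ | c <;> simp
      rw [List.append_assoc, List.singleton_append, mergeSum_concat, h1]
      have h3 : l ++ [p, q] = (l ++ [p]) ++ [q] := by simp
      simp only [rightMul_concat, mergeSum_mul_right, h3]
      rw [_root_.mul_assoc]
      linear_combination (norm := abel) h2 (F l * (β p * β q)) + h2 (S.mergeSum F (l ++ [p]) * β q)
  have hM : leftMul β (rightMul β F) l + rightMul β (leftMul β F) l = 0 := by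
    rcases l with _ | ⟨p, l⟩
    · simp [leftMul]
    rcases List.eq_nil_or_concat' l with rfl | ⟨l, q, rfl⟩
    · have : rightMul β (leftMul β F) ([] ++ [p]) = 0 := by rw [rightMul_concat]; simp [leftMul]
      simpa [leftMul] using this
    · rw [← List.cons_append, rightMul_concat]
      simp only [List.cons_append, leftMul, rightMul_concat, _root_.mul_assoc]
      exact h2 _
  have hl : ∀ G K : List X → A, leftMul β (G + K) l = leftMul β G l + leftMul β K l := by
    intro G K; cases l <;> simp [leftMul, mul_add]
  have hr : ∀ G K : List X → A, rightMul β (G + K) l = rightMul β G l + rightMul β K l := by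
    intro G K; rcases List.eq_nil_or_concat' l with rfl | ⟨l, q, rfl⟩ <;> simp [add_mul]
  have e : S.barDiff β F = S.mergeSum F + (leftMul β F + rightMul β F) := rfl
  rw [barDiff, outer, e, mergeSum_add, mergeSum_add, hl, hl, hr, hr, S.mergeSum_mergeSum h2]
  rw [Pi.zero_apply]
  linear_combination (norm := abel) hL + hR + hM

end Diff

/-! ### The matching of non-reduced lists. -/

section Split

open Classical in
/-- Split off the first letter of the first entry that is not a letter, provided that the entries
before it are letters with vanishing consecutive products. -/
noncomputable def split : List X → Option (List X)
  | [] => none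
  | p :: l => (S.fac p).elim
      (if ∀ q ∈ l.head?, S.mul p q = none then (split l).map (p :: ·) else none)
      fun x => some (x.1 :: x.2 :: l)

/-- Lists that contain a letter with nonzero product with the next entry, all previous entries being
letters. -/
inductive IsSplit : List X → Prop
  | here (p q l) : S.fac p = none → S.mul p q ≠ none → IsSplit (p :: q :: l)
  | there (p l) : S.fac p = none → IsSplit l → IsSplit (p :: l)

/-- Lists of letters with vanishing consecutive products. -/
def Reduced (l : List X) : Prop :=
  (∀ p ∈ l, S.fac p = none) ∧ l.IsChain fun p q => S.mul p q = none

variable {S}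

theorem IsSplit.split_eq_none {l : List X} (h : S.IsSplit l) : S.split l = none := by
  induction h with
  | here p q l h1 h2 => simp [split, h1, h2]
  | there p l h1 _ ih => simp [split, h1, ih]

/-- The preimage is found by merging at the first place where a letter has nonzero product with the
next entry. -/
theorem IsSplit.exists_split {l : List X} (h : S.IsSplit l) : ∃ m, S.split m = some l := by
  induction h with
  | here p q l h1 h2 =>
    obtain ⟨c, hc⟩ := Option.ne_none_iff_exists'.1 h2
    exact ⟨c :: l, by simp [split, (S.fac_eq_some c p q).2 ⟨h1, hc⟩]⟩
  | there p l h1 h ih =>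
    obtain ⟨m, hm⟩ := ih
    by_cases hc : ∀ q ∈ l.head?, S.mul p q = none
    · refine ⟨p :: m, ?_⟩
      have : ∀ q ∈ m.head?, S.mul p q = none := by
        rcases m with _ | ⟨a, m⟩
        · simp
        rcases hf : S.fac a with _ | ⟨x, y⟩
        · simp only [split, hf, Option.elim_none] at hm
          split_ifs at hm with h'
          obtain ⟨l', -, rfl⟩ := Option.map_eq_some_iff.1 hm
          simpa using hc
        · simp only [split, hf, Option.elim_some, Option.some.injEq] at hm
          subst hm
          -- The head `a = x * y` of the preimage has first letter `x`, so by `mul_front` its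
          -- product with `p` vanishes together with that of `x`.
          have := hc x (by simp)
          have h3 := ((S.fac_eq_some a x y).1 hf).2
          simpa using (S.mul_front p x y a h3).1 this
      simp only [split, h1, Option.elim_none, if_pos this, hm, Option.map_some]
    · push Not at hc
      obtain ⟨q, hq, hq'⟩ := hc
      obtain ⟨c, hc⟩ := Option.ne_none_iff_exists'.1 hq'
      rcases l with _ | ⟨a, l⟩
      · simp at hq
      obtain rfl : a = q := by simpa using hq
      exact ⟨c :: l, by simp [split, (S.fac_eq_some c p a).2 ⟨h1, hc⟩]⟩

/-- The search performed by `split` fails either by running out of entries, or at a letter having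
nonzero product with its successor. -/
theorem reduced_or_isSplit {l : List X} (h : S.split l = none) : S.Reduced l ∨ S.IsSplit l := by
  induction l with
  | nil => left; simp [Reduced]
  | cons p l ih =>
    rcases hf : S.fac p with _ | ⟨x, y⟩
    · simp only [split, hf, Option.elim_none] at h
      split_ifs at h with h'
      · rcases ih (by simpa using h) with h1 | h1
        · left
          refine ⟨by simpa [hf] using h1.1, ?_⟩
          rw [List.isChain_cons]
          exact ⟨h', h1.2⟩
        · exact Or.inr (.there _ _ hf h1)
      · push Not at h'
        obtain ⟨q, hq, hq'⟩ := h'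
        rcases l with _ | ⟨a, l⟩
        · simp at hq
        obtain rfl : a = q := by simpa using hq
        exact Or.inr (.here _ _ _ hf hq')
    · simp [split, hf] at h

theorem Reduced.split_eq_none {l : List X} (h : S.Reduced l) : S.split l = none := by
  induction l with
  | nil => simp [split]
  | cons p l ih =>
    have h3 := h.2
    rw [List.isChain_cons] at h3
    have h1 := ih ⟨fun q hq => h.1 q (by simp [hq]), h3.2⟩
    simp [split, h.1 p (by simp), h1]

theorem Reduced.tail {p : X} {l : List X} (h : S.Reduced (p :: l)) : S.Reduced l :=
  ⟨fun q hq => h.1 q (by simp [hq]), h.2.tail⟩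

theorem Reduced.dropLast {l : List X} (h : S.Reduced l) : S.Reduced l.dropLast :=
  ⟨fun q hq => h.1 q (List.mem_of_mem_dropLast hq), h.2.dropLast⟩

theorem exists_cons_of_split {p : X} {l l' : List X} (h : S.split (p :: l) = some l') :
    ∃ q m, l' = q :: m ∧ ∀ x, S.mul x p = none → S.mul x q = none := by
  rcases hf : S.fac p with _ | ⟨x, y⟩
  · simp only [split, hf, Option.elim_none] at h
    split_ifs at h with h'
    obtain ⟨m, -, rfl⟩ := Option.map_eq_some_iff.1 h
    exact ⟨p, m, rfl, fun _ h => h⟩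
  · simp only [split, hf, Option.elim_some, Option.some.injEq] at h
    refine ⟨x, _, h.symm, fun z hz => ?_⟩
    exact (S.mul_front z x y p ((S.fac_eq_some p x y).1 hf).2).2 hz

variable {A : Type*} [NonUnitalRing A]

/-- A merge either keeps the head `q` or extends it on the right, and by `mul_front` neither makes
its product with `x` vanish. -/
theorem mergeSum_eq_zero_of_head {F : List X → A} {x q : X} {l : List X}
    (hq : S.mul x q ≠ none) (h : ∀ q' m, S.mul x q' ≠ none → F (q' :: m) = 0) :
    S.mergeSum F (q :: l) = 0 := by
  rcases l with _ | ⟨a, l⟩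
  · rfl
  have : ∀ (K : List X → A) (a : X) (l : List X), (∀ m, K m = 0) → S.mergeSum K (a :: l) = 0 := by
    intro K a l hK
    rw [show K = 0 from funext hK, mergeSum_zero]
  rw [mergeSum, this _ _ _ fun m => h q m hq, add_zero]
  rcases hc : S.mul q a with _ | c
  · rfl
  · exact h c l fun hx => hq ((S.mul_front x q a c hc).2 hx)

/-- Merges of `l'` before the cut have vanishing product, the merge at the cut restores `l`, and
merges after it leave a list satisfying `IsSplit`, where `F` vanishes. -/
theorem mergeSum_split {F : List X → A} (hF : ∀ l, S.IsSplit l → F l = 0) {l l' : List X}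
    (h : S.split l = some l') : S.mergeSum F l' = F l := by
  induction l generalizing F l' with
  | nil => simp [split] at h
  | cons p l ih =>
    rcases hf : S.fac p with _ | ⟨x, y⟩
    · simp only [split, hf, Option.elim_none] at h
      split_ifs at h with h'
      obtain ⟨m, hm, rfl⟩ := Option.map_eq_some_iff.1 h
      rcases l with _ | ⟨a, l⟩
      · simp [split] at hm
      obtain ⟨q, m, rfl, hq⟩ := exists_cons_of_split hm
      have h3 : S.mul p q = none := hq p (h' a (by simp))
      rw [mergeSum, h3, Option.elim_none, zero_add]
      exact ih (F := fun l => F (p :: l)) (fun l hl => hF _ (.there _ _ hf hl)) hm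
    · simp only [split, hf, Option.elim_some, Option.some.injEq] at h
      subst h
      obtain ⟨hx, hc⟩ := (S.fac_eq_some p x y).1 hf
      have : S.mul x y ≠ none := by simp [hc]
      rw [mergeSum, hc, Option.elim_some, mergeSum_eq_zero_of_head this, add_zero]
      exact fun q m hq => hF _ (.here _ _ _ hx hq)

theorem mergeSum_reduced (F : List X → A) {l : List X} (h : S.Reduced l) :
    S.mergeSum F l = 0 := by
  induction l generalizing F with
  | nil => rfl
  | cons p l ih =>
    rcases l with _ | ⟨q, l⟩
    · rfl
    · have := h.2.rel
      rw [mergeSum, this, ih _ h.tail, Option.elim_none, add_zero]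

variable (S)

/-- The total size of a list of monomials. -/
def totalSize (l : List X) : ℕ := (l.map S.size).sum

variable {S}

theorem totalSize_split {l l' : List X} (h : S.split l = some l') :
    S.totalSize l' = S.totalSize l := by
  induction l generalizing l' with
  | nil => simp [split] at h
  | cons p l ih =>
    rcases hf : S.fac p with _ | ⟨x, y⟩
    · simp only [split, hf, Option.elim_none] at h
      split_ifs at h with h'
      obtain ⟨m, hm, rfl⟩ := Option.map_eq_some_iff.1 h
      have := ih hm
      simp only [totalSize, List.map_cons, List.sum_cons] at this ⊢
      omega
    · simp only [split, hf, Option.elim_some, Option.some.injEq] at h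
      subst h
      have := S.size_mul _ _ _ ((S.fac_eq_some p x y).1 hf).2
      simp only [totalSize, List.map_cons, List.sum_cons]
      omega

/-- The outer terms drop an entry, which has positive size. This makes recursion on the total size
possible. -/
theorem outer_congr (β : X → A) {F G : List X → A} {l : List X}
    (h : ∀ m, S.totalSize m < S.totalSize l → F m = G m) : outer β F l = outer β G l := by
  have hl : leftMul β F l = leftMul β G l := by
    rcases l with _ | ⟨p, l⟩
    · rfl
    · have := S.size_pos p
      rw [leftMul, leftMul, h]
      simp only [totalSize, List.map_cons, List.sum_cons]
      omega
  have hr : rightMul β F l = rightMul β G l := by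
    rcases List.eq_nil_or_concat' l with rfl | ⟨l, p, rfl⟩
    · rfl
    · have := S.size_pos p
      rw [rightMul_concat, rightMul_concat, h]
      simp only [totalSize, List.map_append, List.sum_append, List.map_cons, List.sum_cons]
      omega
  rw [outer, outer, hl, hr]

/-- Removing the first or last entry of a reduced list leaves a reduced list. -/
theorem outer_reduced (β : X → A) {F : List X → A} (hF : ∀ m, S.Reduced m → F m = 0)
    {l : List X} (h : S.Reduced l) : outer β F l = 0 := by
  have hl : leftMul β F l = 0 := by
    rcases l with _ | ⟨p, l⟩
    · rfl
    · rw [leftMul, hF _ h.tail, mul_zero]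
  have hr : rightMul β F l = 0 := by
    have := h.dropLast
    rcases List.eq_nil_or_concat' l with rfl | ⟨l, p, rfl⟩
    · rfl
    · rw [rightMul_concat, hF _ (by simpa using this), zero_mul]
  rw [outer, hl, hr, add_zero]

end Split

/-! ### The contracting homotopy. -/

section Homotopy

variable {K A : Type*} [CommRing K] [NonUnitalRing A] [Module K A] [IsScalarTower K A A]
  [SMulCommClass K A A]

/-- Precomposition with `split`. -/
noncomputable def splitMap (K : Type*) [CommRing K] [Module K A] :
    (List X → A) →ₗ[K] (List X → A) where
  toFun F l := (S.split l).elim 0 F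
  map_add' F G := by funext l; rcases h : S.split l <;> simp [h]
  map_smul' x F := by funext l; rcases h : S.split l <;> simp [h]

/-- The outer terms of the differential, as a linear map. -/
def outerLin (K : Type*) [CommRing K] [Module K A] [IsScalarTower K A A]
    [SMulCommClass K A A] (β : X → A) : (List X → A) →ₗ[K] (List X → A) where
  toFun := outer β
  map_add' F G := by
    funext l
    have hl : leftMul β (F + G) l = leftMul β F l + leftMul β G l := by
      cases l <;> simp [leftMul, mul_add]
    have hr : rightMul β (F + G) l = rightMul β F l + rightMul β G l := by
      rcases List.eq_nil_or_concat' l with rfl | ⟨l, q, rfl⟩ <;> simp [add_mul]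
    simp only [outer, hl, hr, Pi.add_apply]
    abel
  map_smul' x F := by
    funext l
    have hl : leftMul β (x • F) l = x • leftMul β F l := by
      cases l <;> simp [leftMul, mul_smul_comm]
    have hr : rightMul β (x • F) l = x • rightMul β F l := by
      rcases List.eq_nil_or_concat' l with rfl | ⟨l, q, rfl⟩ <;> simp [smul_mul_assoc]
    simp only [outer, hl, hr, Pi.smul_apply, smul_add, RingHom.id_apply]

/-- The differential as a linear map. -/
def barDiffLin (K : Type*) [CommRing K] [Module K A] [IsScalarTower K A A]
    [SMulCommClass K A A] (β : X → A) : (List X → A) →ₗ[K] (List X → A) where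
  toFun := S.barDiff β
  map_add' F G := by
    funext l
    have := congrFun ((outerLin K β).map_add F G) l
    change outer β (F + G) l = outer β F l + outer β G l at this
    simp only [barDiff, mergeSum_add, this, Pi.add_apply]
    abel
  map_smul' x F := by
    funext l
    have := congrFun ((outerLin K β).map_smul x F) l
    change outer β (x • F) l = x • outer β F l at this
    simp only [barDiff, mergeSum_smul, this, Pi.smul_apply, smul_add, RingHom.id_apply]

/-- Approximations to the contracting homotopy. -/
noncomputable def homotopyAux (K : Type*) [CommRing K] [Module K A] [IsScalarTower K A A]
    [SMulCommClass K A A] (β : X → A) : ℕ → (List X → A) →ₗ[K] (List X → A)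
  | 0 => 0
  | k + 1 => S.splitMap K ∘ₗ (LinearMap.id + outerLin K β ∘ₗ homotopyAux K β k)

theorem homotopyAux_succ (β : X → A) (k : ℕ) (F : List X → A) (l : List X) :
    S.homotopyAux K β (k + 1) F l =
      (S.split l).elim 0 fun l' => F l' + outer β (S.homotopyAux K β k F) l' := rfl

/-- The homotopy that contracts the cochains vanishing on reduced lists. -/
noncomputable def homotopy (K : Type*) [CommRing K] [Module K A] [IsScalarTower K A A]
    [SMulCommClass K A A] (β : X → A) : (List X → A) →ₗ[K] (List X → A) :=
  LinearMap.pi fun l => LinearMap.proj l ∘ₗ S.homotopyAux K β (S.totalSize l)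

theorem homotopy_apply (β : X → A) (F : List X → A) (l : List X) :
    S.homotopy K β F l = S.homotopyAux K β (S.totalSize l) F l := rfl

/-- Cutting preserves the total size and the outer terms lower it, so the recursion has stabilised
after as many rounds as the total size. -/
theorem homotopyAux_eq (β : X → A) (F : List X → A) (k : ℕ) (l : List X)
    (h : S.totalSize l ≤ k) : S.homotopyAux K β k F l = S.homotopy K β F l := by
  induction k using Nat.strong_induction_on generalizing l with
  | _ k ih =>
    rcases k with _ | k
    · obtain h := Nat.le_zero.1 h
      rw [homotopy_apply, h]
    rcases hk : S.totalSize l with _ | k'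
    · rcases l with _ | ⟨p, l⟩
      · rw [homotopy_apply, hk, homotopyAux_succ]; rfl
      · have := S.size_pos p
        simp only [totalSize, List.map_cons, List.sum_cons] at hk
        omega
    rw [homotopy_apply, hk, homotopyAux_succ, homotopyAux_succ]
    rcases hs : S.split l with _ | l'
    · rfl
    · have h1 := totalSize_split hs
      simp only [Option.elim_some]
      rw [outer_congr (S := S) β (G := S.homotopyAux K β k' F)]
      intro m hm
      rw [ih k (by omega) _ (by omega), ih k' (by omega) _ (by omega)]

/-- The recursive equation characterising the homotopy, freed of the bound on the number of rounds.
-/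
theorem homotopy_eq (β : X → A) (F : List X → A) (l : List X) :
    S.homotopy K β F l = (S.split l).elim 0 fun l' => F l' + outer β (S.homotopy K β F) l' := by
  rw [← S.homotopyAux_eq β F _ l (Nat.le_succ _), homotopyAux_succ]
  rcases hs : S.split l with _ | l'
  · rfl
  · have h1 := totalSize_split hs
    simp only [Option.elim_some]
    rw [outer_congr (S := S) β]
    intro m hm
    exact S.homotopyAux_eq β F _ m (by omega)

theorem homotopy_reduced (β : X → A) (F : List X → A) {l : List X} (h : S.Reduced l) :
    S.homotopy K β F l = 0 := by
  rw [homotopy_eq, h.split_eq_none, Option.elim_none]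

/-- A cocycle that vanishes on reduced lists is the coboundary of its image under the homotopy. -/
theorem barDiff_homotopy (h2 : ∀ a : A, a + a = 0) (β : X → A)
    (hβ : ∀ p q, β p * β q = (S.mul p q).elim 0 β) (F : List X → A)
    (hF : S.barDiff β F = 0) (hF0 : ∀ l, S.Reduced l → F l = 0) :
    S.barDiff β (S.homotopy K β F) = F := by
  set G := S.homotopy K β F with hG
  have hGs : ∀ l, S.IsSplit l → G l = 0 := fun l hl => by
    rw [hG, homotopy_eq, hl.split_eq_none, Option.elim_none]
  set E := S.barDiff β G + F with hE
  have hDE : S.barDiff β E = 0 := by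
    have : S.barDiff β E = S.barDiff β (S.barDiff β G) + S.barDiff β F :=
      (S.barDiffLin K β).map_add _ _
    rw [this, hF, S.barDiff_barDiff h2 β hβ, add_zero]
  -- The recursive equation for `G` says precisely that the error `E` vanishes on results of cuts.
  have hs : ∀ l, S.IsSplit l → E l = 0 := by
    intro l' hl'
    obtain ⟨l, hl⟩ := hl'.exists_split
    rw [hE, Pi.add_apply, barDiff, mergeSum_split hGs hl]
    nth_rewrite 1 [hG]
    rw [homotopy_eq, hl, Option.elim_some, ← hG]
    linear_combination (norm := abel) h2 (F l') + h2 (outer β G l')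
  have hEz : ∀ k l, S.totalSize l = k → E l = 0 := by
    intro k
    induction k using Nat.strong_induction_on with
    | _ k ih =>
      intro l hk
      rcases hl : S.split l with _ | l'
      · rcases reduced_or_isSplit hl with h | h
        · rw [hE, Pi.add_apply, barDiff, mergeSum_reduced _ h, hF0 _ h,
            outer_reduced β (fun m hm => S.homotopy_reduced β F hm) h]
          simp
        · exact hs l h
      -- Evaluating `barDiff E = 0` on the cut list `l'` gives `E l` plus outer terms, which vanish
      -- by induction.
      · have h1 := congrFun hDE l'
        have h3 := totalSize_split hl
        rw [barDiff, mergeSum_split hs hl, outer_congr (S := S) β (G := 0)] at h1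
        · have : outer β (0 : List X → A) l' = 0 := congrFun (outerLin K β).map_zero l'
          simpa [this] using h1
        · intro m hm
          exact ih _ (by omega) m rfl
  funext l
  have := hEz _ l rfl
  rw [hE, Pi.add_apply] at this
  linear_combination (norm := abel) this - h2 (F l)

end Homotopy

end QuadSystem


/-! ### Monomials of a quadratic monomial path algebra as a `QuadSystem`. -/

section Paths

variable {N : ℕ} {r : Letter → Letter → Prop}

variable (N r) in
/-- The monomials other than the idempotents. -/
abbrev NIPath : Type := {p : Path N r // p.word ≠ []}

namespace NIPath

open Classical in
/-- The product of two monomials other than idempotents. -/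
noncomputable def mul (p q : NIPath N r) : Option (NIPath N r) :=
  if h : p.1.target = q.1.start ∧ (p.1.word ++ q.1.word).IsChain r then
    some ⟨⟨p.1.start, p.1.word ++ q.1.word, h.2⟩, by simp [p.2]⟩
  else none

theorem map_mul (p q : NIPath N r) : (mul p q).map Subtype.val = p.1.comp q.1 := by
  unfold mul Path.comp
  split_ifs <;> rfl

theorem mul_eq_some {p q c : NIPath N r} : mul p q = some c ↔ p.1.comp q.1 = some c.1 := by
  rw [← map_mul]
  rcases mul p q with _ | d <;> simp [Subtype.ext_iff]

theorem mul_eq_some_iff {p q c : NIPath N r} : mul p q = some c ↔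
    p.1.target = q.1.start ∧ c.1.start = p.1.start ∧ c.1.word = p.1.word ++ q.1.word := by
  rw [mul_eq_some, Path.comp_eq_some]

theorem mul_eq_none {p q : NIPath N r} : mul p q = none ↔
    (p.1.target = q.1.start → ∃ x ∈ p.1.word.getLast?, ∃ y ∈ q.1.word.head?, ¬ r x y) := by
  unfold mul
  split_ifs with h <;> simp only [List.isChain_append, p.1.chain, q.1.chain, true_and] at h
  · simp only [false_iff]
    intro h'
    obtain ⟨x, hx, y, hy, hxy⟩ := h' h.1
    exact hxy (h.2 x hx y hy)
  · simp only [true_iff]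
    intro h1
    by_contra! h2
    exact h ⟨h1, h2⟩

/-- Factor a monomial other than a letter as its first letter times the rest. -/
def fac : NIPath N r → Option (NIPath N r × NIPath N r)
  | ⟨⟨_, [], _⟩, h⟩ => (h rfl).elim
  | ⟨⟨_, [_], _⟩, _⟩ => none
  | ⟨⟨i, x :: y :: w, h⟩, _⟩ =>
    some (⟨⟨i, [x], List.isChain_singleton x⟩, by simp⟩, ⟨⟨x.next i, y :: w, h.tail⟩, by simp⟩)

theorem fac_eq_none {p : NIPath N r} : fac p = none ↔ p.1.word.length = 1 := by
  rcases p with ⟨⟨i, _ | ⟨x, _ | ⟨y, w⟩⟩, h⟩, h'⟩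
  · exact (h' rfl).elim
  · simp [fac]
  · simp [fac]

theorem fac_eq_some (p x q : NIPath N r) :
    fac p = some (x, q) ↔ fac x = none ∧ mul x q = some p := by
  rw [fac_eq_none, mul_eq_some_iff]
  rcases p with ⟨⟨i, _ | ⟨a, _ | ⟨b, w⟩⟩, h⟩, h'⟩
  · exact (h' rfl).elim
  · simp only [fac, reduceCtorEq, false_iff]
    rintro ⟨h1, -, -, h2⟩
    have := congrArg List.length h2
    have h3 := List.length_pos_of_ne_nil q.2
    simp at this
    omega
  · simp only [fac, Option.some.injEq, Prod.mk.injEq]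
    constructor
    · rintro ⟨rfl, rfl⟩
      simp [Path.target]
    · rintro ⟨h1, h2, h3, h4⟩
      obtain ⟨c, hc⟩ := List.length_eq_one_iff.1 h1
      rw [hc] at h4
      simp only [List.singleton_append, List.cons.injEq] at h4
      obtain ⟨rfl, h4⟩ := h4
      simp only [Path.target, hc, List.foldl_cons, List.foldl_nil, ← h3] at h2
      exact ⟨Subtype.ext (Path.ext h3 hc.symm), Subtype.ext (Path.ext h2 h4)⟩

end NIPath

variable (N r) in
/-- The monomials other than idempotents of a quadratic monomial algebra. -/
noncomputable def quad : QuadSystem (NIPath N r) where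
  mul := NIPath.mul
  fac := NIPath.fac
  size p := p.1.word.length
  mul_assoc p q s := by
    have h1 : ∀ o : Option (NIPath N r), (o.bind fun c => c.mul s).map Subtype.val =
        (o.map Subtype.val).bind fun c => c.comp s.1 := by
      rintro (_ | c)
      · rfl
      · exact NIPath.map_mul c s
    have h2 : ∀ o : Option (NIPath N r), (o.bind fun c => p.mul c).map Subtype.val =
        (o.map Subtype.val).bind fun c => p.1.comp c := by
      rintro (_ | c)
      · rfl
      · exact NIPath.map_mul p c
    apply Option.map_injective Subtype.val_injective
    rw [h1, h2, NIPath.map_mul, NIPath.map_mul, Path.comp_assoc]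
  fac_eq_some := NIPath.fac_eq_some
  mul_front p q s c h := by
    obtain ⟨h1, h2, h3⟩ := NIPath.mul_eq_some_iff.1 h
    have : c.1.word.head? = q.1.word.head? := by
      rw [h3, List.head?_append_of_ne_nil _ q.2]
    rw [NIPath.mul_eq_none, NIPath.mul_eq_none, this, h2]
  size_pos p := List.length_pos_of_ne_nil p.2
  size_mul p q c h := by
    rw [(NIPath.mul_eq_some_iff.1 h).2.2, List.length_append]

/-- A monomial as an element of the algebra. -/
noncomputable def NIPath.toAlg (p : NIPath N r) : Alg N r := Alg.basis p.1

theorem NIPath.toAlg_mul (p q : NIPath N r) :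
    p.toAlg * q.toAlg = ((quad N r).mul p q).elim 0 NIPath.toAlg := by
  rw [toAlg, toAlg, Alg.basis_mul_basis, ← map_mul]
  change _ = (p.mul q).elim _ _
  rcases p.mul q with _ | c <;> rfl

theorem Alg.add_self (a : Alg N r) : a + a = 0 := by
  rw [← two_smul R a, show (2 : R) = 0 from CharTwo.two_eq_zero, zero_smul]

end Paths

/-! ### Spans of terms satisfying a condition, and gradings. -/

section Monomials

variable {N : ℕ} {r : Letter → Letter → Prop}

/-- The monomial `V₀ ^ e 0 * V_{N+1} ^ e 1`. -/
noncomputable def vMon (e : Fin 2 →₀ ℕ) : R := MvPolynomial.monomial e 1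

/-- The sums of terms `V₀ ^ e 0 * V_{N+1} ^ e 1 * p` with `P p e`. -/
noncomputable def monoSpace (P : Path N r → (Fin 2 →₀ ℕ) → Prop) : AddSubmonoid (Alg N r) :=
  AddSubmonoid.closure {a | ∃ q e, P q e ∧ a = vMon e • Alg.basis q}

theorem vMon_smul_mem {P : Path N r → (Fin 2 →₀ ℕ) → Prop} {q : Path N r} {e : Fin 2 →₀ ℕ}
    (h : P q e) : vMon e • Alg.basis q ∈ monoSpace P :=
  AddSubmonoid.subset_closure ⟨q, e, h, rfl⟩

theorem mem_monoSpace {P : Path N r → (Fin 2 →₀ ℕ) → Prop} {a : Alg N r} :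
    a ∈ monoSpace P ↔ ∀ q e, e ∈ (Alg.basis.repr a q).support → P q e := by
  classical
  constructor
  · intro h
    induction h using AddSubmonoid.closure_induction with
    | mem a h =>
      obtain ⟨q, e, h, rfl⟩ := h
      intro q' e' he
      rw [map_smul, Module.Basis.repr_self, Finsupp.smul_apply, Finsupp.single_apply] at he
      split_ifs at he with hq
      · subst hq
        rw [smul_eq_mul, mul_one, vMon, MvPolynomial.mem_support_iff,
          MvPolynomial.coeff_monomial] at he
        split_ifs at he with h1
        · exact h1 ▸ h
        · exact (he rfl).elim
      · simp at he
    | zero => intro q e he; simp at he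
    | add a b _ _ ha hb =>
      intro q e he
      rw [map_add, Finsupp.add_apply] at he
      rcases Finset.mem_union.1 (MvPolynomial.support_add he) with h | h
      · exact ha q e h
      · exact hb q e h
  · intro h
    rw [← Alg.basis.linearCombination_repr a, Finsupp.linearCombination_apply, Finsupp.sum]
    refine sum_mem fun q _ => ?_
    -- Over `𝔽₂` every nonzero coefficient is 1, so sums of terms suffice and no scalars are needed.
    have : Alg.basis.repr a q = ∑ e ∈ (Alg.basis.repr a q).support, vMon e := by
      conv_lhs => rw [(Alg.basis.repr a q).as_sum]
      refine Finset.sum_congr rfl fun e he => ?_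
      rw [MvPolynomial.mem_support_iff] at he
      rw [Fin.eq_one_of_ne_zero _ he]
      rfl
    rw [this, Finset.sum_smul]
    exact sum_mem fun e he => vMon_smul_mem (h q e he)

theorem monoSpace_mono {P Q : Path N r → (Fin 2 →₀ ℕ) → Prop} (h : ∀ q e, P q e → Q q e) :
    monoSpace P ≤ monoSpace Q := fun _ ha =>
  mem_monoSpace.2 fun q e he => h q e (mem_monoSpace.1 ha q e he)

theorem basis_mul_mem {P Q : Path N r → (Fin 2 →₀ ℕ) → Prop} (p : Path N r)
    (h : ∀ q c e, P q e → p.comp q = some c → Q c e) {a : Alg N r} (ha : a ∈ monoSpace P) :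
    Alg.basis p * a ∈ monoSpace Q := by
  induction ha using AddSubmonoid.closure_induction with
  | mem a ha =>
    obtain ⟨q, e, hq, rfl⟩ := ha
    rw [mul_smul_comm, Alg.basis_mul_basis]
    rcases hc : p.comp q with _ | c
    · rw [Alg.ofOption, smul_zero]; exact zero_mem _
    · exact vMon_smul_mem (h q c e hq hc)
  | zero => rw [mul_zero]; exact zero_mem _
  | add a b _ _ ha hb => rw [mul_add]; exact add_mem ha hb

theorem mul_basis_mem {P Q : Path N r → (Fin 2 →₀ ℕ) → Prop} (p : Path N r)
    (h : ∀ q c e, P q e → q.comp p = some c → Q c e) {a : Alg N r} (ha : a ∈ monoSpace P) :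
    a * Alg.basis p ∈ monoSpace Q := by
  induction ha using AddSubmonoid.closure_induction with
  | mem a ha =>
    obtain ⟨q, e, hq, rfl⟩ := ha
    rw [smul_mul_assoc, Alg.basis_mul_basis]
    rcases hc : q.comp p with _ | c
    · rw [Alg.ofOption, smul_zero]; exact zero_mem _
    · exact vMon_smul_mem (h q c e hq hc)
  | zero => rw [zero_mul]; exact zero_mem _
  | add a b _ _ ha hb => rw [add_mul]; exact add_mem ha hb

theorem smul_mem_monoSpace {P Q : Path N r → (Fin 2 →₀ ℕ) → Prop} (x : R)
    (h : ∀ q e e', P q e → e' ∈ x.support → Q q (e' + e)) {a : Alg N r} (ha : a ∈ monoSpace P) :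
    x • a ∈ monoSpace Q := by
  classical
  refine mem_monoSpace.2 fun q e he => ?_
  rw [map_smul, Finsupp.smul_apply, smul_eq_mul] at he
  obtain ⟨e1, h1, e2, h2, rfl⟩ := Finset.mem_add.1 (MvPolynomial.support_mul _ _ he)
  exact h q e2 e1 (mem_monoSpace.1 ha q e2 h2) h1

theorem isHomogeneous_iff {D : Datum} {α : AlexGroup N} {μ : ℤ} {a : D.A N} :
    D.IsHomogeneous α μ a ↔ a ∈ monoSpace fun p e =>
      alexCoeff e + alexWord p.start p.word = α ∧
        e 0 * D.mV 0 + e 1 * D.mV 1 + p.word.length * D.mGen = μ :=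
  mem_monoSpace.symm

theorem alexCoeff_zero : alexCoeff (N := N) 0 = 0 := by
  funext ⟨i, x⟩
  cases x <;> simp [alexCoeff]

theorem alexCoeff_add (e e' : Fin 2 →₀ ℕ) :
    alexCoeff (N := N) (e + e') = alexCoeff e + alexCoeff e' := by
  funext ⟨i, x⟩
  cases x
  · simp [alexCoeff]
  · simp [alexCoeff]; ring

theorem alexWord_append (i : ZMod N) (v w : List Letter) :
    alexWord i (v ++ w) = alexWord i v + alexWord (v.foldl Letter.next i) w := by
  induction v generalizing i with
  | nil => simp [alexWord]
  | cons x v ih => simp [alexWord, ih, add_assoc]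

end Monomials

/-! ### Endpoints and gradings of lists, and their invariance under merging. -/

section Lists

variable {N : ℕ} {r : Letter → Letter → Prop}

/-- The entries of the list are composable, from the idempotent `i` to the idempotent `k`. -/
def Compat : ZMod N → List (NIPath N r) → ZMod N → Prop
  | i, [], k => i = k
  | i, p :: l, k => p.1.start = i ∧ Compat p.1.target l k

/-- The Alexander grading of a list of monomials. -/
noncomputable def alexList (l : List (NIPath N r)) : AlexGroup N :=
  (l.map fun p => alexWord p.1.start p.1.word).sum

/-- The number of letters in a list of monomials. -/
def lettersList (l : List (NIPath N r)) : ℕ := (l.map fun p => p.1.word.length).sum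

/-- One list of monomials arises from the other by multiplying two neighbours. -/
inductive Merge : List (NIPath N r) → List (NIPath N r) → Prop
  | here (p q c l) : NIPath.mul p q = some c → Merge (p :: q :: l) (c :: l)
  | there (p l m) : Merge l m → Merge (p :: l) (p :: m)

theorem Merge.length {l m : List (NIPath N r)} (h : Merge l m) : l.length = m.length + 1 := by
  induction h with
  | here => simp
  | there p l m h ih => simp [ih]

theorem comp_target {p q c : Path N r} (h : p.comp q = some c) : c.target = q.target := by
  obtain ⟨h1, h2, h3⟩ := Path.comp_eq_some.1 h
  rw [Path.target, h2, h3, List.foldl_append]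
  exact congrArg (fun i => List.foldl Letter.next i q.word) h1

theorem comp_alex {p q c : Path N r} (h : p.comp q = some c) :
    alexWord c.start c.word = alexWord p.start p.word + alexWord q.start q.word := by
  obtain ⟨h1, h2, h3⟩ := Path.comp_eq_some.1 h
  rw [h2, h3, alexWord_append, ← h1]
  rfl

theorem comp_length {p q c : Path N r} (h : p.comp q = some c) :
    c.word.length = p.word.length + q.word.length := by
  rw [(Path.comp_eq_some.1 h).2.2, List.length_append]

theorem Merge.compat {l m : List (NIPath N r)} (h : Merge l m) (i k : ZMod N) :
    Compat i l k ↔ Compat i m k := by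
  induction h generalizing i with
  | here p q c l h =>
    obtain ⟨h1, h2, -⟩ := NIPath.mul_eq_some_iff.1 h
    have h4 := comp_target (NIPath.mul_eq_some.1 h)
    simp only [Compat, h2, h4, h1, true_and]
  | there p l m h ih => simp only [Compat, ih]

theorem Merge.alex {l m : List (NIPath N r)} (h : Merge l m) : alexList l = alexList m := by
  induction h with
  | here p q c l h =>
    simp only [alexList, List.map_cons, List.sum_cons, comp_alex (NIPath.mul_eq_some.1 h),
      add_assoc]
  | there p l m h ih => simp only [alexList, List.map_cons, List.sum_cons] at ih ⊢; rw [ih]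

theorem Merge.letters {l m : List (NIPath N r)} (h : Merge l m) :
    lettersList l = lettersList m := by
  induction h with
  | here p q c l h =>
    simp only [lettersList, List.map_cons, List.sum_cons, comp_length (NIPath.mul_eq_some.1 h),
      add_assoc]
  | there p l m h ih => simp only [lettersList, List.map_cons, List.sum_cons] at ih ⊢; rw [ih]

theorem merge_of_split {l l' : List (NIPath N r)} (h : (quad N r).split l = some l') :
    Merge l' l := by
  induction l generalizing l' with
  | nil => simp [QuadSystem.split] at h
  | cons p l ih =>
    rcases hf : (quad N r).fac p with _ | ⟨x, y⟩
    · simp only [QuadSystem.split, hf, Option.elim_none] at h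
      split_ifs at h with h'
      obtain ⟨m, hm, rfl⟩ := Option.map_eq_some_iff.1 h
      exact .there _ _ _ (ih hm)
    · simp only [QuadSystem.split, hf, Option.elim_some, Option.some.injEq] at h
      subst h
      exact .here _ _ _ _ (((quad N r).fac_eq_some p x y).1 hf).2

theorem mergeSum_mem (T : AddSubmonoid (Alg N r)) (F : List (NIPath N r) → Alg N r)
    (l : List (NIPath N r)) (h : ∀ m, Merge l m → F m ∈ T) : (quad N r).mergeSum F l ∈ T := by
  induction l generalizing F with
  | nil => exact zero_mem _
  | cons p l ih =>
    rcases l with _ | ⟨q, l⟩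
    · exact zero_mem _
    · refine add_mem ?_ (ih _ fun m hm => h _ (.there _ _ _ hm))
      rcases hc : (quad N r).mul p q with _ | c
      · exact zero_mem _
      · exact h _ (.here _ _ _ _ hc)

theorem compat_concat {i k : ZMod N} {l : List (NIPath N r)} {p : NIPath N r} :
    Compat i (l ++ [p]) k ↔ Compat i l p.1.start ∧ p.1.target = k := by
  induction l generalizing i with
  | nil => simp [Compat, eq_comm]
  | cons q l ih => simp [Compat, ih, and_assoc]

end Lists

/-! ### Bigraded cochains on lists. -/

section Good

variable {N : ℕ} (D : Datum)

/-- The term `V₀ ^ e 0 * V_{N+1} ^ e 1 * q` may occur in the value on `l` of a homogeneous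
`n`-cochain whose Maslov grading exceeds that of the list by `c`. -/
def Adm (n : ℕ) (c : ℤ) (l : List (NIPath N D.rel)) (q : Path N D.rel) (e : Fin 2 →₀ ℕ) : Prop :=
  l.length = n ∧ Compat q.start l q.target ∧
    alexCoeff e + alexWord q.start q.word = alexList l ∧
    e 0 * D.mV 0 + e 1 * D.mV 1 + q.word.length * D.mGen = lettersList l * D.mGen + c

/-- Homogeneous cochains, as functions on lists of monomials. -/
def Good (n : ℕ) (c : ℤ) (F : List (NIPath N D.rel) → Alg N D.rel) : Prop :=
  ∀ l, F l ∈ monoSpace (Adm D n c l)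

variable (N) in
/-- The `R`-module generated by the homogeneous cochains. -/
noncomputable def goodSpan (n : ℕ) (c : ℤ) : Submodule R (List (NIPath N D.rel) → Alg N D.rel) :=
  Submodule.span R {F | Good D n c F}

variable {D}

theorem Good.zero (n : ℕ) (c : ℤ) : Good (N := N) D n c 0 := fun _ => zero_mem _

theorem Good.add {n : ℕ} {c : ℤ} {F G : List (NIPath N D.rel) → Alg N D.rel}
    (hF : Good D n c F) (hG : Good D n c G) : Good D n c (F + G) := fun l =>
  add_mem (hF l) (hG l)

/-- Merging lowers the length by one and preserves all other data. Hence `c`, which stands for `n +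
j`, is unchanged by the differential and the homotopy. -/
theorem adm_merge {n : ℕ} {c : ℤ} {l m : List (NIPath N D.rel)} (h : Merge l m)
    (q : Path N D.rel) (e : Fin 2 →₀ ℕ) : Adm D (n + 1) c l q e ↔ Adm D n c m q e := by
  simp only [Adm, h.length, h.compat, h.alex, h.letters, Nat.add_right_cancel_iff]

theorem Good.mergeSum {n : ℕ} {c : ℤ} {F : List (NIPath N D.rel) → Alg N D.rel}
    (hF : Good D n c F) : Good D (n + 1) c ((quad N D.rel).mergeSum F) := fun _ =>
  mergeSum_mem _ _ _ fun m hm => monoSpace_mono (fun q e h => (adm_merge hm q e).2 h) (hF m)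

theorem Good.outer {n : ℕ} {c : ℤ} {F : List (NIPath N D.rel) → Alg N D.rel}
    (hF : Good D n c F) : Good D (n + 1) c (QuadSystem.outer NIPath.toAlg F) := by
  intro l
  refine add_mem ?_ ?_
  · rcases l with _ | ⟨p, l⟩
    · exact zero_mem _
    · refine basis_mul_mem p.1 (fun q x e ⟨h1, h2, h3, h4⟩ hx => ⟨?_, ?_, ?_, ?_⟩) (hF l)
      · simp [h1]
      · obtain ⟨h5, h6, -⟩ := Path.comp_eq_some.1 hx
        refine ⟨h6.symm, ?_⟩
        rw [comp_target hx, h5]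
        exact h2
      · rw [comp_alex hx, alexList, List.map_cons, List.sum_cons, ← alexList, ← h3]
        abel
      · rw [comp_length hx, lettersList, List.map_cons, List.sum_cons, ← lettersList]
        push_cast
        linarith
  · rcases List.eq_nil_or_concat' l with rfl | ⟨l, p, rfl⟩
    · exact zero_mem _
    · rw [QuadSystem.rightMul_concat]
      refine mul_basis_mem p.1 (fun q x e ⟨h1, h2, h3, h4⟩ hx => ⟨?_, ?_, ?_, ?_⟩) (hF l)
      · simp [h1]
      · obtain ⟨h5, h6, -⟩ := Path.comp_eq_some.1 hx
        rw [compat_concat, h6, ← h5, comp_target hx]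
        exact ⟨h2, rfl⟩
      · rw [comp_alex hx, alexList, List.map_append, List.sum_append, ← alexList, ← h3]
        simp only [List.map_cons, List.map_nil, List.sum_cons, List.sum_nil]
        abel
      · rw [comp_length hx, lettersList, List.map_append, List.sum_append, ← lettersList]
        simp only [List.map_cons, List.map_nil, List.sum_cons, List.sum_nil]
        push_cast
        linarith

theorem Good.barDiff {n : ℕ} {c : ℤ} {F : List (NIPath N D.rel) → Alg N D.rel}
    (hF : Good D n c F) : Good D (n + 1) c ((quad N D.rel).barDiff NIPath.toAlg F) :=
  hF.mergeSum.add hF.outer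

/-- A list is a merge of its cut, so the cut undoes the increase of `n` caused by the outer terms.
-/
theorem Good.homotopyAux {n : ℕ} {c : ℤ} {F : List (NIPath N D.rel) → Alg N D.rel}
    (hF : Good D (n + 1) c F) (k : ℕ) :
    Good D n c ((quad N D.rel).homotopyAux R NIPath.toAlg k F) := by
  induction k with
  | zero => exact Good.zero n c
  | succ k ih =>
    intro l
    rw [QuadSystem.homotopyAux_succ]
    rcases h : (quad N D.rel).split l with _ | l'
    · exact zero_mem _
    · refine monoSpace_mono (fun q e h' => (adm_merge (merge_of_split h) q e).1 h') ?_
      exact hF.add ih.outer l'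

theorem Good.homotopy {n : ℕ} {c : ℤ} {F : List (NIPath N D.rel) → Alg N D.rel}
    (hF : Good D (n + 1) c F) :
    Good D n c ((quad N D.rel).homotopy R NIPath.toAlg F) := fun l =>
  hF.homotopyAux _ l

theorem homotopy_mem_goodSpan {n : ℕ} {c : ℤ} {F : List (NIPath N D.rel) → Alg N D.rel}
    (hF : F ∈ goodSpan N D (n + 1) c) :
    (quad N D.rel).homotopy R NIPath.toAlg F ∈ goodSpan N D n c := by
  have : goodSpan N D (n + 1) c ≤
      (goodSpan N D n c).comap ((quad N D.rel).homotopy R NIPath.toAlg) :=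
    Submodule.span_le.2 fun F hF => Submodule.subset_span (Good.homotopy hF)
  exact this hF

/-- The way in which degree counts restrict arbitrary bigraded cochains: `T = ⊥` gives vanishing,
and `T` spanned by one term gives a single coefficient. -/
theorem apply_mem_of_goodSpan {n : ℕ} {c : ℤ} {F : List (NIPath N D.rel) → Alg N D.rel}
    (hF : F ∈ goodSpan N D n c) (l : List (NIPath N D.rel)) (T : Submodule R (Alg N D.rel))
    (hT : ∀ q e, Adm D n c l q e → vMon e • Alg.basis q ∈ T) : F l ∈ T := by
  have : goodSpan N D n c ≤ T.comap (LinearMap.proj l) := by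
    refine Submodule.span_le.2 fun F hF => ?_
    have h1 : monoSpace (Adm D n c l) ≤ T.toAddSubmonoid :=
      AddSubmonoid.closure_le.2 fun a ⟨q, e, h, ha⟩ => ha ▸ hT q e h
    exact h1 (hF l)
  exact this hF

end Good


/-! ### Tuples read off from lists. -/

section Tuples

/-- The first `n` entries of a list, mapped by `g`, and completed by `d`. -/
def vec {X T : Type*} (d : T) (g : X → T) {n : ℕ} (l : List X) : Fin n → T :=
  fun i => l[(i : ℕ)]?.elim d g

variable {X T : Type*} (d : T) (g : X → T)

theorem vec_cons {n : ℕ} (p : X) (l : List X) :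
    vec (n := n + 1) d g (p :: l) = Fin.cons (g p) (vec d g l) := by
  funext i
  refine Fin.cases ?_ (fun i => ?_) i <;> simp [vec]

theorem vec_of_length {n : ℕ} {l : List X} (h : l.length = n) (i : Fin n) :
    vec d g l i = g (l[(i : ℕ)]'(h ▸ i.2)) := by
  simp [vec, h]

theorem vec_concat_castSucc {n : ℕ} {l : List X} (h : l.length = n) (q : X) :
    (fun i : Fin n => vec d g (l ++ [q]) i.castSucc) = vec d g l := by
  funext i
  simp [vec, h]

theorem vec_concat_last {n : ℕ} {l : List X} (h : l.length = n) (q : X) :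
    vec d g (l ++ [q]) (Fin.last n) = g q := by
  simp [vec, ← h]

theorem sum_vec {T : Type*} [AddCommMonoid T] (g : X → T) {n : ℕ} {l : List X}
    (h : l.length = n) : ∑ i : Fin n, vec 0 g l i = (l.map g).sum := by
  induction l generalizing n with
  | nil => subst h; simp
  | cons p l ih =>
    subst h
    refine (congrArg (fun v : Fin (l.length + 1) → T => ∑ i, v i) (vec_cons 0 g p l)).trans ?_
    rw [Fin.sum_univ_succ]
    simp [ih]

end Tuples

/-! ### The inner part of the differential on tuples, and multilinearity. -/

section Contract

variable {K M A : Type*} [CommRing K]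

/-- The inner part of the Hochschild differential. -/
def contractSum [Mul M] [AddCommMonoid A] {n : ℕ} (f : (Fin n → M) → A) (a : Fin (n + 1) → M) :
    A :=
  ∑ i : Fin n, f (Fin.contractNth i.castSucc (fun x y => x * y) a)

/-- The same recursion as the one defining `mergeSum`, so that the two sums can be compared by
induction. -/
theorem contractSum_cons [Mul M] [AddCommMonoid A] {n : ℕ} (f : (Fin (n + 1) → M) → A) (x y : M)
    (v : Fin n → M) : contractSum f (Fin.cons x (Fin.cons y v)) =
      f (Fin.cons (x * y) v) + contractSum (fun w => f (Fin.cons x w)) (Fin.cons y v) := by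
  rw [contractSum, Fin.sum_univ_succ, contractSum]
  congr 1
  · congr 1
    funext k
    refine Fin.cases ?_ (fun k => ?_) k
    · rw [Fin.contractNth_apply_of_eq _ _ _ _ (by simp)]
      rfl
    · rw [Fin.contractNth_apply_of_gt _ _ _ _ (by simp)]
      rfl
  · refine Finset.sum_congr rfl fun i _ => ?_
    congr 1
    funext k
    refine Fin.cases ?_ (fun k => ?_) k
    · rw [Fin.contractNth_apply_of_lt _ _ _ _ (by simp)]
      rfl
    · rw [Fin.cons_succ]
      rcases lt_trichotomy (k : ℕ) i with h | h | h
      · rw [Fin.contractNth_apply_of_lt _ _ _ _ (by simpa using h),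
          Fin.contractNth_apply_of_lt _ _ _ _ (by simpa using h)]
        rfl
      · rw [Fin.contractNth_apply_of_eq _ _ _ _ (by simpa using h),
          Fin.contractNth_apply_of_eq _ _ _ _ (by simpa using h)]
        rfl
      · rw [Fin.contractNth_apply_of_gt _ _ _ _ (by simpa using h),
          Fin.contractNth_apply_of_gt _ _ _ _ (by simpa using h)]
        rfl

variable (K) [AddCommGroup M] [Module K M] [AddCommGroup A] [Module K A]

/-- The function is linear in every variable. -/
def IsMultilinear {n : ℕ} (f : (Fin n → M) → A) : Prop :=
  ∃ F : MultilinearMap K (fun _ : Fin n => M) A, ⇑F = f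

variable {K}

/-- Currying the first variable lets multilinearity follow the recursion on lists. -/
theorem isMultilinear_succ {n : ℕ} {f : (Fin (n + 1) → M) → A} : IsMultilinear K f ↔
    (∀ v, IsLinearMap K fun x => f (Fin.cons x v)) ∧
      ∀ x, IsMultilinear K fun v => f (Fin.cons x v) := by
  constructor
  · rintro ⟨F, rfl⟩
    refine ⟨fun v => ⟨fun x y => F.cons_add v x y, fun c x => F.cons_smul v c x⟩, fun x => ?_⟩
    exact ⟨F.curryLeft x, rfl⟩
  · rintro ⟨h1, h2⟩
    choose F hF using h2
    let G : M →ₗ[K] MultilinearMap K (fun _ : Fin n => M) A :=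
      { toFun := F
        map_add' := fun x y => by
          ext v
          have h3 := fun x => congrFun (hF x) v
          simp only [add_apply, h3]
          exact (h1 v).map_add x y
        map_smul' := fun c x => by
          ext v
          have h3 := fun x => congrFun (hF x) v
          simp only [smul_apply, h3]
          exact (h1 v).map_smul c x }
    refine ⟨LinearMap.uncurryLeft G, ?_⟩
    funext v
    refine (congrFun (hF (v 0)) (Fin.tail v)).trans ?_
    rw [Fin.cons_self_tail]

theorem IsMultilinear.add {n : ℕ} {f g : (Fin n → M) → A} (hf : IsMultilinear K f)
    (hg : IsMultilinear K g) : IsMultilinear K fun v => f v + g v := by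
  obtain ⟨F, rfl⟩ := hf
  obtain ⟨G, rfl⟩ := hg
  exact ⟨F + G, rfl⟩

end Contract

section ContractLinear

variable {K M A : Type*} [CommRing K] [NonUnitalRing M] [Module K M] [IsScalarTower K M M]
  [SMulCommClass K M M] [AddCommGroup A] [Module K A]

theorem IsMultilinear.contractSum {n : ℕ} {f : (Fin n → M) → A} (hf : IsMultilinear K f) :
    IsMultilinear K (contractSum f) := by
  induction n with
  | zero => exact ⟨0, by funext a; simp [StarAlg.contractSum]⟩
  | succ n ih =>
    obtain ⟨h1, h2⟩ := isMultilinear_succ.1 hf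
    refine isMultilinear_succ.2 ⟨fun v => ?_, fun x => ?_⟩
    · rw [← Fin.cons_self_tail v]
      simp only [contractSum_cons]
      have h3 : ∀ w, IsLinearMap K fun x => f (Fin.cons x w) := h1
      constructor
      · intro x y
        simp only [StarAlg.contractSum, add_mul, (h3 _).map_add, Finset.sum_add_distrib]
        abel
      · intro c x
        simp only [StarAlg.contractSum, smul_mul_assoc, (h3 _).map_smul, Finset.smul_sum,
          smul_add]
    · have h3 : IsMultilinear K fun v : Fin (n + 1) → M =>
          f (Fin.cons (x * v 0) (Fin.tail v)) := by
        refine isMultilinear_succ.2 ⟨fun v => ?_, fun y => ?_⟩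
        · simp only [Fin.cons_zero, Fin.tail_cons]
          constructor
          · intro y z
            simp only [mul_add, (h1 _).map_add]
          · intro c y
            simp only [mul_smul_comm, (h1 _).map_smul]
        · simp only [Fin.cons_zero, Fin.tail_cons]
          exact h2 _
      have h4 := h3.add (ih (h2 x))
      convert h4 using 2 with v
      conv_lhs => rw [← Fin.cons_self_tail v]
      rw [contractSum_cons, Fin.cons_self_tail]

end ContractLinear

/-! ### From multilinear cochains to functions on lists of monomials. -/

section Transfer

variable {N : ℕ} {D : Datum}

/-- The monomials other than idempotents form a basis of the augmentation ideal. -/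
noncomputable def plusBasis {r : Letter → Letter → Prop} :
    Module.Basis (NIPath N r) R (Alg.plus N r) := by
  classical
  exact Module.Basis.ofRepr
    { toFun := fun a => (Alg.basis.repr a.1).subtypeDomain _
      map_add' := fun a b => by ext; simp
      map_smul' := fun x a => by ext; simp
      invFun := fun g => ⟨Alg.basis.repr.symm g.extendDomain, fun i => by
        rw [LinearEquiv.apply_symm_apply, Finsupp.extendDomain_apply]
        exact dif_neg fun h => h rfl⟩
      left_inv := fun a => by
        apply Subtype.ext
        apply Alg.basis.repr.injective
        rw [LinearEquiv.apply_symm_apply]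
        refine Finsupp.extendDomain_subtypeDomain _ fun p hp h => ?_
        have h1 : p = Path.idem p.start := Path.ext rfl h
        rw [h1] at hp
        exact Finsupp.mem_support_iff.1 hp (a.2 _)
      right_inv := fun g => by
        beta_reduce
        rw [LinearEquiv.apply_symm_apply, Finsupp.subtypeDomain_extendDomain] }

theorem plusBasis_repr {r : Letter → Letter → Prop} (a : Alg.plus N r) (p : NIPath N r) :
    plusBasis.repr a p = Alg.basis.repr a.1 p.1 := rfl

theorem plusBasis_coe {r : Letter → Letter → Prop} (p : NIPath N r) :
    ((plusBasis p : Alg.plus N r) : Alg N r) = p.toAlg := by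
  apply Alg.basis.repr.injective
  ext1 q
  rw [NIPath.toAlg, Module.Basis.repr_self]
  by_cases hq : q.word = []
  · have h1 : q = Path.idem q.start := Path.ext rfl hq
    have h3 : q ≠ p.1 := fun h => p.2 (h ▸ hq)
    rw [Finsupp.single_eq_of_ne h3, h1]
    exact (plusBasis p).2 _
  · have := plusBasis_repr (plusBasis p) ⟨q, hq⟩
    rw [← this, Module.Basis.repr_self]
    by_cases h : p = ⟨q, hq⟩
    · subst h; simp
    · rw [Finsupp.single_eq_of_ne (Ne.symm h), Finsupp.single_eq_of_ne]
      exact fun h' => h (Subtype.ext h'.symm)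

variable (D) in
/-- The values of a function of `n` variables on monomials, as a function on lists. -/
noncomputable def onLists (n : ℕ) :
    ((Fin n → D.APlus N) → D.A N) →ₗ[R] (List (NIPath N D.rel) → Alg N D.rel) where
  toFun f l := if l.length = n then f (vec 0 plusBasis l) else 0
  map_add' f g := by funext l; by_cases h : l.length = n <;> simp [h]
  map_smul' x f := by funext l; by_cases h : l.length = n <;> simp [h]

theorem onLists_apply {n : ℕ} (f : (Fin n → D.APlus N) → D.A N) {l : List (NIPath N D.rel)}
    (h : l.length = n) : onLists D n f l = f (vec 0 plusBasis l) := if_pos h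

theorem onLists_of_ne {n : ℕ} (f : (Fin n → D.APlus N) → D.A N) {l : List (NIPath N D.rel)}
    (h : l.length ≠ n) : onLists D n f l = 0 := if_neg h

theorem onLists_cons {n : ℕ} (f : (Fin (n + 1) → D.APlus N) → D.A N) (p : NIPath N D.rel) :
    (fun l => onLists D (n + 1) f (p :: l)) =
      onLists D n fun v => f (Fin.cons (plusBasis p) v) := by
  funext l
  by_cases h : l.length = n
  · rw [onLists_apply _ (by simp [h]), onLists_apply _ h, vec_cons]
  · rw [onLists_of_ne _ (by simpa using h), onLists_of_ne _ h]

theorem plusBasis_mul {r : Letter → Letter → Prop} (p q : NIPath N r) :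
    plusBasis p * plusBasis q = ((quad N r).mul p q).elim 0 (plusBasis (N := N)) := by
  apply Subtype.ext
  have : ((plusBasis p * plusBasis q : Alg.plus N r) : Alg N r) =
      (plusBasis p : Alg.plus N r).1 * (plusBasis q : Alg.plus N r).1 := rfl
  rw [this, plusBasis_coe, plusBasis_coe, NIPath.toAlg_mul]
  rcases (quad N r).mul p q with _ | c
  · rfl
  · exact (plusBasis_coe c).symm

theorem mergeSum_onLists {n : ℕ} {f : (Fin n → D.APlus N) → D.A N} (hf : IsMultilinear R f)
    {l : List (NIPath N D.rel)} (hl : l.length = n + 1) :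
    (quad N D.rel).mergeSum (onLists D n f) l = contractSum f (vec 0 plusBasis l) := by
  induction n generalizing l with
  | zero =>
    obtain ⟨p, rfl⟩ := List.length_eq_one_iff.1 hl
    simp [contractSum, QuadSystem.mergeSum]
  | succ n ih =>
    rcases l with _ | ⟨p, _ | ⟨q, l⟩⟩
    · simp at hl
    · simp at hl
    obtain ⟨h1, h2⟩ := isMultilinear_succ.1 hf
    simp only [List.length_cons, Nat.add_right_cancel_iff] at hl
    rw [QuadSystem.mergeSum, onLists_cons, ih (h2 _) (by simp [hl]), vec_cons, vec_cons, vec_cons,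
      contractSum_cons, plusBasis_mul]
    congr 1
    rcases (quad N D.rel).mul p q with _ | c
    · exact ((h1 _).map_zero).symm
    · rw [Option.elim_some, onLists_apply _ (by simp [hl]), vec_cons, Option.elim_some]

/-- Multilinearity is needed where a product of neighbours vanishes: the tuple sum then evaluates
`f` at a zero entry, whereas `mergeSum` omits the term. -/
theorem onLists_diff {n : ℕ} {f : (Fin n → D.APlus N) → D.A N} (hf : IsMultilinear R f) :
    onLists D (n + 1) (D.diff N n f) =
      (quad N D.rel).barDiff NIPath.toAlg (onLists D n f) := by
  funext l
  by_cases h : l.length = n + 1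
  · rw [onLists_apply _ h, QuadSystem.barDiff, mergeSum_onLists hf h]
    change ((vec 0 plusBasis l (0 : Fin (n + 1)) : D.APlus N) : D.A N) *
        f (fun i => vec 0 plusBasis l i.succ)
      + contractSum f (vec 0 plusBasis l)
      + f (fun i => vec 0 plusBasis l i.castSucc) *
        ((vec 0 plusBasis l (Fin.last n) : D.APlus N) : D.A N) = _
    have hL : ((vec 0 plusBasis l (0 : Fin (n + 1)) : D.APlus N) : D.A N) *
        f (fun i => vec 0 plusBasis l i.succ) =
        QuadSystem.leftMul NIPath.toAlg (onLists D n f) l := by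
      rcases l with _ | ⟨p, l⟩
      · simp at h
      · rw [vec_cons, Fin.cons_zero, plusBasis_coe, QuadSystem.leftMul,
          onLists_apply _ (by simpa using h)]
        simp only [Fin.cons_succ]
    have hR : f (fun i => vec 0 plusBasis l i.castSucc) *
        ((vec 0 plusBasis l (Fin.last n) : D.APlus N) : D.A N) =
        QuadSystem.rightMul NIPath.toAlg (onLists D n f) l := by
      rcases List.eq_nil_or_concat' l with rfl | ⟨l, p, rfl⟩
      · simp at h
      · have h' : l.length = n := by simpa using h
        rw [vec_concat_castSucc _ _ h', vec_concat_last _ _ h', plusBasis_coe,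
          QuadSystem.rightMul_concat, onLists_apply _ h']
    rw [hL, hR, QuadSystem.outer]
    abel
  · rw [onLists_of_ne _ h, QuadSystem.barDiff, QuadSystem.outer]
    -- All three parts evaluate on lists one entry shorter than `l`, hence of length different from
    -- `n`.
    have h1 : (quad N D.rel).mergeSum (onLists D n f) l = 0 := by
      have := mergeSum_mem ⊥ (onLists D n f) l fun m hm => by
        rw [onLists_of_ne _ fun h' => h (by rw [hm.length, h'])]
        exact zero_mem _
      simpa using this
    have hL : QuadSystem.leftMul NIPath.toAlg (onLists D n f) l = 0 := by
      rcases l with _ | ⟨p, l⟩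
      · rfl
      · rw [QuadSystem.leftMul, onLists_of_ne _ (by simpa using h), mul_zero]
    have hR : QuadSystem.rightMul NIPath.toAlg (onLists D n f) l = 0 := by
      rcases List.eq_nil_or_concat' l with rfl | ⟨l, p, rfl⟩
      · rfl
      · rw [QuadSystem.rightMul_concat, onLists_of_ne _ (by simpa using h), zero_mul]
    rw [h1, hL, hR, add_zero, add_zero]

theorem IsMultilinear.diff {n : ℕ} {f : (Fin n → D.APlus N) → D.A N} (hf : IsMultilinear R f) :
    IsMultilinear R (D.diff N n f) := by
  refine IsMultilinear.add (IsMultilinear.add ?_ hf.contractSum) ?_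
  · refine isMultilinear_succ.2 ⟨fun v => ?_, fun x => ?_⟩
    · simp only [Fin.cons_zero, Fin.cons_succ]
      exact ⟨fun x y => add_mul _ _ _, fun c x => smul_mul_assoc _ _ _⟩
    · simp only [Fin.cons_zero, Fin.cons_succ]
      obtain ⟨F, rfl⟩ := hf
      exact ⟨(LinearMap.mulLeft R (x : D.A N)).compMultilinearMap F, rfl⟩
  · obtain ⟨F, rfl⟩ := hf
    let G : MultilinearMap R (fun _ : Fin n => D.APlus N) (D.APlus N →ₗ[R] D.A N) :=
      (((LinearMap.mul R (D.A N)).compl₂ (Alg.plus N D.rel).subtype) : _ →ₗ[R] _).compMultilinearMap F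
    exact ⟨MultilinearMap.uncurryRight G, rfl⟩

theorem onLists_injective {n : ℕ} {f g : (Fin n → D.APlus N) → D.A N} (hf : IsMultilinear R f)
    (hg : IsMultilinear R g) (h : onLists D n f = onLists D n g) : f = g := by
  obtain ⟨F, rfl⟩ := hf
  obtain ⟨G, rfl⟩ := hg
  congr 1
  refine Module.Basis.ext_multilinear (fun _ => plusBasis) fun v => ?_
  have := congrFun h (List.ofFn v)
  rw [onLists_apply _ (by simp), onLists_apply _ (by simp)] at this
  have h3 : (vec 0 plusBasis (List.ofFn v) : Fin n → D.APlus N) = fun i => plusBasis (v i) := by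
    funext i
    rw [vec_of_length _ _ (by simp)]
    simp
  rwa [h3] at this

end Transfer


/-! ### The correspondence between bigraded cochains and graded functions on lists. -/

section Hom

variable {N : ℕ} {D : Datum}

variable (N) in
/-- The multilinear map with given values on lists of monomials. -/
noncomputable def ofLists {r : Letter → Letter → Prop} : (n : ℕ) →
    (List (NIPath N r) → Alg N r) → MultilinearMap R (fun _ : Fin n => Alg.plus N r) (Alg N r)
  | 0, F => MultilinearMap.constOfIsEmpty R _ (F [])
  | n + 1, F => LinearMap.uncurryLeft (plusBasis.constr R fun p => ofLists n fun l => F (p :: l))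

theorem idem_eq {r : Letter → Letter → Prop} (i : ZMod N) :
    (Alg.idem i : Alg N r) = Alg.basis (Path.idem i) := rfl

theorem ofLists_succ {r : Letter → Letter → Prop} (n : ℕ) (F : List (NIPath N r) → Alg N r)
    (a : Fin (n + 1) → Alg.plus N r) : ofLists N (n + 1) F a =
      (plusBasis.repr (a 0)).sum fun p x => x • ofLists N n (fun l => F (p :: l)) (Fin.tail a) := by
  rw [ofLists, LinearMap.uncurryLeft_apply, Module.Basis.constr_apply, Finsupp.sum, Finsupp.sum,
    sum_apply]
  rfl

theorem ofLists_vec {r : Letter → Letter → Prop} (n : ℕ) (F : List (NIPath N r) → Alg N r)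
    (l : List (NIPath N r)) (h : l.length = n) :
    ofLists N n F (vec 0 plusBasis l) = F l := by
  induction n generalizing l F with
  | zero =>
    obtain rfl := List.length_eq_zero_iff.1 h
    rfl
  | succ n ih =>
    rcases l with _ | ⟨p, l⟩
    · simp at h
    rw [ofLists_succ, vec_cons, Fin.cons_zero, Fin.tail_cons, Module.Basis.repr_self,
      Finsupp.sum_single_index (by simp), one_smul, ih _ _ (by simpa using h)]

/-- The monomial `V₀ ^ e 0 * V_{N+1} ^ e 1` times the list `l` occurs in the expansion of the
tuple `a`. -/
def Term {r : Letter → Letter → Prop} : {n : ℕ} → (Fin n → Alg.plus N r) →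
    List (NIPath N r) → (Fin 2 →₀ ℕ) → Prop
  | 0, _, l, e => l = [] ∧ e = 0
  | _ + 1, a, l, e => ∃ p l' e₁ e₂, l = p :: l' ∧ e = e₁ + e₂ ∧
      e₁ ∈ (Alg.basis.repr (a 0).1 p.1).support ∧ Term (Fin.tail a) l' e₂

theorem vMon_zero : vMon 0 = 1 := by
  rw [vMon, MvPolynomial.monomial_zero', MvPolynomial.C_1]

theorem vMon_add (e e' : Fin 2 →₀ ℕ) : vMon (e + e') = vMon e * vMon e' := by
  rw [vMon, vMon, vMon, MvPolynomial.monomial_mul, one_mul]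

theorem eq_sum_vMon (x : R) : x = ∑ e ∈ x.support, vMon e := by
  conv_lhs => rw [x.as_sum]
  refine Finset.sum_congr rfl fun e he => ?_
  rw [MvPolynomial.mem_support_iff] at he
  rw [Fin.eq_one_of_ne_zero _ he]
  rfl

/-- The value is the sum of `vMon e • F l` over the terms of the expanded tuple. The induction
varies `T`, which absorbs the coefficient of the first entry. -/
theorem ofLists_mem {r : Letter → Letter → Prop} {n : ℕ} (F : List (NIPath N r) → Alg N r)
    (a : Fin n → Alg.plus N r) (T : AddSubmonoid (Alg N r))
    (h : ∀ l e, Term a l e → vMon e • F l ∈ T) : ofLists N n F a ∈ T := by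
  induction n generalizing F T with
  | zero =>
    have := h [] 0 ⟨rfl, rfl⟩
    rwa [vMon_zero, one_smul] at this
  | succ n ih =>
    rw [ofLists_succ, Finsupp.sum]
    refine sum_mem fun p _ => ?_
    rw [eq_sum_vMon (plusBasis.repr (a 0) p), Finset.sum_smul]
    refine sum_mem fun e he => ?_
    refine ih (fun l => F (p :: l)) (Fin.tail a)
      (T.comap (DistribSMul.toAddMonoidHom (Alg N r) (vMon e))) fun l e' h' => ?_
    rw [AddSubmonoid.mem_comap, DistribSMul.toAddMonoidHom_apply, smul_smul, ← vMon_add]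
    exact h _ _ ⟨p, l, e, e', rfl, rfl, he, h'⟩

theorem Term.grading {n : ℕ} {a : Fin n → D.APlus N}
    {l : List (NIPath N D.rel)} {e : Fin 2 →₀ ℕ} (h : Term a l e) (α : Fin n → AlexGroup N)
    (μ : Fin n → ℤ) (ha : ∀ i, D.IsHomogeneous (α i) (μ i) (a i : D.A N)) :
    alexCoeff e + alexList l = ∑ i, α i ∧
      e 0 * D.mV 0 + e 1 * D.mV 1 + lettersList l * D.mGen = ∑ i, μ i := by
  induction n generalizing l e with
  | zero =>
    obtain ⟨rfl, rfl⟩ := h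
    simp [alexCoeff_zero, alexList, lettersList]
  | succ n ih =>
    obtain ⟨p, l', e₁, e₂, rfl, rfl, h1, h2⟩ := h
    obtain ⟨h3, h4⟩ := ih h2 (Fin.tail α) (Fin.tail μ) fun i => ha i.succ
    obtain ⟨h5, h6⟩ := ha 0 p.1 e₁ h1
    rw [Fin.sum_univ_succ, Fin.sum_univ_succ]
    change _ = α 0 + ∑ i, Fin.tail α i ∧ _ = μ 0 + ∑ i, Fin.tail μ i
    rw [← h3, ← h4, ← h5, ← h6, alexCoeff_add]
    constructor
    · simp only [alexList, List.map_cons, List.sum_cons]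
      abel
    · simp only [lettersList, List.map_cons, List.sum_cons, Finsupp.add_apply]
      push_cast
      ring

theorem idem_mul_basis {r : Letter → Letter → Prop} (i : ZMod N) (p : Path N r) :
    Alg.idem i * Alg.basis p = if i = p.start then Alg.basis p else 0 := by
  rw [Alg.idem, Alg.basis_mul_basis]
  split_ifs with h
  · rw [(Path.comp_eq_some (p := Path.idem i) (q := p) (c := p)).2 ⟨(h : (Path.idem i).target = _), h.symm, rfl⟩, Alg.ofOption]
  · rcases hc : (Path.idem i).comp p with _ | c
    · rfl
    · exact (h (Path.comp_eq_some.1 hc).1).elim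

theorem basis_mul_idem {r : Letter → Letter → Prop} (i : ZMod N) (p : Path N r) :
    Alg.basis p * Alg.idem i = if p.target = i then Alg.basis p else 0 := by
  rw [Alg.idem, Alg.basis_mul_basis]
  split_ifs with h
  · rw [(Path.comp_eq_some (p := p) (q := Path.idem i) (c := p)).2 ⟨h, rfl, by simp [Path.idem]⟩, Alg.ofOption]
  · rcases hc : p.comp (Path.idem i) with _ | c
    · rfl
    · exact (h (Path.comp_eq_some.1 hc).1).elim

theorem mem_monoSpace_true {r : Letter → Letter → Prop} (a : Alg N r) :
    a ∈ monoSpace fun _ _ => True := mem_monoSpace.2 fun _ _ _ => trivial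

theorem start_eq_of_idem_mul {r : Letter → Letter → Prop} {i : ZMod N} {a : Alg N r}
    (h : Alg.idem i * a = a) {p : Path N r} {e : Fin 2 →₀ ℕ}
    (he : e ∈ (Alg.basis.repr a p).support) : p.start = i := by
  have h1 := basis_mul_mem (P := fun _ _ => True) (Q := fun p _ => p.start = i)
    (Path.idem i) (fun q c e _ hc => (Path.comp_eq_some.1 hc).2.1) (mem_monoSpace_true a)
  rw [← idem_eq, h] at h1
  exact mem_monoSpace.1 h1 p e he

theorem target_eq_of_mul_idem {r : Letter → Letter → Prop} {i : ZMod N} {a : Alg N r}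
    (h : a * Alg.idem i = a) {p : Path N r} {e : Fin 2 →₀ ℕ}
    (he : e ∈ (Alg.basis.repr a p).support) : p.target = i := by
  have h1 := mul_basis_mem (P := fun _ _ => True) (Q := fun p _ => p.target = i)
    (Path.idem i) (fun q c e _ hc => comp_target hc) (mem_monoSpace_true a)
  rw [← idem_eq, h] at h1
  exact mem_monoSpace.1 h1 p e he

theorem Term.idems {r : Letter → Letter → Prop} {n : ℕ} {a : Fin n → Alg.plus N r}
    {l : List (NIPath N r)} {e : Fin 2 →₀ ℕ} (h : Term a l e) (u w : Fin n → ZMod N)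
    (ha : ∀ i, Alg.idem (u i) * (a i).1 = (a i).1 ∧ (a i).1 * Alg.idem (w i) = (a i).1) :
    u = vec 0 (fun p => p.1.start) l ∧ w = vec 0 (fun p => p.1.target) l := by
  induction n generalizing l e with
  | zero => exact ⟨Subsingleton.elim _ _, Subsingleton.elim _ _⟩
  | succ n ih =>
    obtain ⟨p, l', e₁, e₂, rfl, rfl, h1, h2⟩ := h
    obtain ⟨h3, h4⟩ := ih h2 (Fin.tail u) (Fin.tail w) fun i => ha i.succ
    rw [vec_cons, vec_cons, ← h3, ← h4, start_eq_of_idem_mul (ha 0).1 h1,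
      target_eq_of_mul_idem (ha 0).2 h1, Fin.cons_self_tail, Fin.cons_self_tail]
    exact ⟨rfl, rfl⟩

/-- Putting `k` before the final idempotents and `m` after the initial ones aligns each end with the
next beginning. -/
theorem compat_iff {r : Letter → Letter → Prop} {n : ℕ} {l : List (NIPath N r)}
    (h : l.length = n) (k m : ZMod N) : Compat k l m ↔
      (Fin.cons k (vec 0 (fun p => p.1.target) l) : Fin (n + 1) → ZMod N) =
        (Fin.snoc (vec 0 (fun p => p.1.start) l) m : Fin (n + 1) → ZMod N) := by
  induction l generalizing n k with
  | nil =>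
    subst h
    rw [Compat, funext_iff]
    refine ⟨fun h i => ?_, fun h => h 0⟩
    have : i = 0 := Fin.fin_one_eq_zero i
    rw [this]
    exact h
  | cons p l ih =>
    subst h
    rw [Compat, ih rfl]
    have h1 : (vec 0 (fun p : NIPath N r => p.1.target) (p :: l) : Fin (l.length + 1) → ZMod N) =
      _ := vec_cons _ _ _ _
    have h2 : (vec 0 (fun p : NIPath N r => p.1.start) (p :: l) : Fin (l.length + 1) → ZMod N) =
      _ := vec_cons _ _ _ _
    change _ ↔ (Fin.cons k (vec 0 (fun p : NIPath N r => p.1.target) (p :: l) :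
        Fin (l.length + 1) → ZMod N) : Fin (l.length + 1 + 1) → ZMod N) =
      Fin.snoc (vec 0 (fun p : NIPath N r => p.1.start) (p :: l) :
        Fin (l.length + 1) → ZMod N) m
    rw [h1, h2, ← Fin.cons_snoc_eq_snoc_cons, Fin.cons_inj]
    exact and_congr_left fun _ => eq_comm

/-- Monomials are homogeneous, so the grading condition on `f` applies directly; the idempotent
condition excludes terms with the wrong endpoints. -/
theorem good_onLists {n : ℕ} {j : ℤ} {f : (Fin n → D.APlus N) → D.A N}
    (hf : f ∈ D.homogeneousCochains N n j) : Good D n (n + j) (onLists D n f) := by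
  intro l
  by_cases h : l.length = n
  swap
  · rw [onLists_of_ne _ h]; exact zero_mem _
  rw [onLists_apply _ h]
  have h1 := hf.2 (vec 0 plusBasis l) (vec 0 (fun p => alexWord p.1.start p.1.word) l)
    (vec 0 (fun p => (p.1.word.length * D.mGen : ℤ)) l) fun i => by
      rw [vec_of_length _ _ h, vec_of_length _ _ h, vec_of_length _ _ h, plusBasis_coe,
        isHomogeneous_iff]
      have := vMon_smul_mem (q := l[(i : ℕ)].1) (e := 0) (P := fun p e =>
        alexCoeff e + alexWord p.start p.word = alexWord l[(i : ℕ)].1.start l[(i : ℕ)].1.word ∧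
        e 0 * D.mV 0 + e 1 * D.mV 1 + p.word.length * D.mGen = l[(i : ℕ)].1.word.length * D.mGen)
        (by simp [alexCoeff_zero])
      rwa [vMon_zero, one_smul] at this
  rw [sum_vec _ h, sum_vec _ h] at h1
  refine mem_monoSpace.2 fun q e he => ⟨h, ?_, (h1 q e he).1, ?_⟩
  · rw [compat_iff h]
    by_contra hne
    have h2 := hf.1.2 (vec 0 plusBasis l) (vec 0 (fun p => p.1.start) l)
      (vec 0 (fun p => p.1.target) l) (fun i => by
        rw [vec_of_length _ _ h, vec_of_length _ _ h, vec_of_length _ _ h, plusBasis_coe,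
          NIPath.toAlg, idem_mul_basis, basis_mul_idem, if_pos rfl, if_pos rfl]
        exact ⟨rfl, rfl⟩) _ _ hne
    -- Multiplying by the end idempotents of `q` on both sides does not change the coefficient of
    -- `q`.
    have h3 : ∀ a : Alg N D.rel,
        Alg.basis.repr (Alg.idem q.start * a * Alg.idem q.target) q = Alg.basis.repr a q := by
      intro a
      have : (Alg.basis.coord q).comp ((LinearMap.mulRight R (Alg.idem q.target)).comp
          (LinearMap.mulLeft R (Alg.idem q.start))) = Alg.basis.coord q := by
        refine Alg.basis.ext fun p => ?_
        change Alg.basis.repr (Alg.idem q.start * Alg.basis p * Alg.idem q.target) q =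
          Alg.basis.repr (Alg.basis p) q
        by_cases hp : q = p
        · subst hp
          rw [idem_mul_basis, if_pos rfl, basis_mul_idem, if_pos rfl]
        · rw [Module.Basis.repr_self, Finsupp.single_eq_of_ne hp, idem_mul_basis]
          split_ifs
          · rw [basis_mul_idem]
            split_ifs
            · rw [Module.Basis.repr_self, Finsupp.single_eq_of_ne hp]
            · simp
          · simp
      exact congrArg (fun f => f a) this
    have h4 := congrArg (fun x => Alg.basis.repr x q) h2
    simp only [h3, map_zero, Finsupp.zero_apply] at h4
    rw [h4] at he
    simp at he
  · rw [(h1 q e he).2, lettersList, Nat.cast_list_sum, ← List.sum_map_mul_right, List.map_map]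
    simp only [Function.comp_def]
    ring

theorem vMon_smul_mem_monoSpace {r : Letter → Letter → Prop}
    {P Q : Path N r → (Fin 2 →₀ ℕ) → Prop} (e' : Fin 2 →₀ ℕ)
    (h : ∀ q e, P q e → Q q (e' + e)) {a : Alg N r} (ha : a ∈ monoSpace P) :
    vMon e' • a ∈ monoSpace Q :=
  smul_mem_monoSpace _ (fun q e e₁ hq he => by
    have : e₁ = e' := Finset.mem_singleton.1 (MvPolynomial.support_monomial_subset he)
    exact this ▸ h q e hq) ha

/-- Both conditions on arbitrary tuples are checked on their terms: `Term.idems` fixes the endpoints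
of the entries and `Term.grading` the total gradings. -/
theorem ofLists_mem_homogeneousCochains {n : ℕ} {j : ℤ}
    {F : List (NIPath N D.rel) → Alg N D.rel} (hF : Good D n (n + j) F) :
    ⇑(ofLists N n F) ∈ D.homogeneousCochains N n j := by
  refine ⟨⟨⟨_, rfl⟩, fun a u w h k m hkm => ?_⟩, fun a α μ h => ?_⟩
  · let f : Alg N D.rel →+ Alg N D.rel :=
      (AddMonoidHom.mulRight (Alg.idem m)).comp (AddMonoidHom.mulLeft (Alg.idem k))
    refine ofLists_mem F a (AddMonoidHom.mker f) fun l e hl => ?_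
    change Alg.idem k * (vMon e • F l) * Alg.idem m = 0
    obtain ⟨rfl, rfl⟩ := hl.idems u w h
    rw [mul_smul_comm, smul_mul_assoc]
    have h1 : Alg.idem k * F l ∈ monoSpace fun q e => Adm D n (n + j) l q e ∧ q.start = k :=
      basis_mul_mem _ (fun q c e hq hc => by
        have h3 := Path.comp_eq_some.1 hc
        have : c = q := Path.ext (h3.2.1.trans h3.1) h3.2.2
        exact this ▸ ⟨hq, h3.1.symm⟩) (hF l)
    have h2 : Alg.idem k * F l * Alg.idem m ∈ monoSpace (N := N) (r := D.rel) fun q e => False :=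
      mul_basis_mem _ (fun q c e hq hc => by
        have h3 := (Path.comp_eq_some.1 hc).1
        obtain ⟨⟨h4, h5, -⟩, rfl⟩ := hq
        rw [compat_iff h4, h3] at h5
        exact hkm h5) h1
    have h4 : Alg.idem k * F l * Alg.idem m = 0 := by
      apply Alg.basis.repr.injective
      ext1 q
      rw [map_zero, Finsupp.zero_apply, ← MvPolynomial.support_eq_empty]
      exact Finset.eq_empty_of_forall_notMem fun e he => mem_monoSpace.1 h2 q e he
    rw [h4, smul_zero]
  · rw [isHomogeneous_iff]
    refine ofLists_mem F a _ fun l e hl => ?_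
    obtain ⟨h1, h2⟩ := hl.grading α μ h
    refine vMon_smul_mem_monoSpace e (fun q e' hq => ?_) (hF l)
    obtain ⟨-, -, h3, h4⟩ := hq
    rw [alexCoeff_add, ← h1, ← h2, ← h3]
    refine ⟨by abel, ?_⟩
    simp only [Finsupp.add_apply]
    push_cast
    linarith

theorem onLists_ofLists {n : ℕ} {c : ℤ} {F : List (NIPath N D.rel) → Alg N D.rel}
    (hF : Good D n c F) : onLists D n (ofLists N n F) = F := by
  funext l
  by_cases h : l.length = n
  · rw [onLists_apply _ h, ofLists_vec _ _ _ h]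
  · rw [onLists_of_ne _ h]
    have : F l ∈ monoSpace (N := N) (r := D.rel) fun q e => False :=
      monoSpace_mono (fun q e hq => h hq.1) (hF l)
    apply Alg.basis.repr.injective
    ext1 q
    symm
    rw [map_zero, Finsupp.zero_apply, ← MvPolynomial.support_eq_empty]
    exact Finset.eq_empty_of_forall_notMem fun e he => mem_monoSpace.1 this q e he

theorem onLists_mem_goodSpan {n : ℕ} {j : ℤ} {f : (Fin n → D.APlus N) → D.A N}
    (hf : f ∈ D.bicochains N n j) : onLists D n f ∈ goodSpan N D n (n + j) := by
  have : D.bicochains N n j ≤ (goodSpan N D n (n + j)).comap (onLists D n) :=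
    Submodule.span_le.2 fun f hf => Submodule.subset_span (good_onLists hf)
  exact this hf

theorem exists_bicochain {n : ℕ} {j : ℤ} {F : List (NIPath N D.rel) → Alg N D.rel}
    (hF : F ∈ goodSpan N D n (n + j)) : ∃ f ∈ D.bicochains N n j, onLists D n f = F := by
  have : goodSpan N D n (n + j) ≤ (D.bicochains N n j).map (onLists D n) :=
    Submodule.span_le.2 fun F hF =>
      ⟨_, Submodule.subset_span (ofLists_mem_homogeneousCochains hF), onLists_ofLists hF⟩
  exact this hF

theorem isMultilinear_of_mem {n : ℕ} {j : ℤ} {f : (Fin n → D.APlus N) → D.A N}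
    (hf : f ∈ D.bicochains N n j) : IsMultilinear R f := by
  have : D.bicochains N n j ≤ D.cochains N n := Submodule.span_le.2 fun f hf => hf.1
  exact (this hf).1

theorem barDiff_onLists_eq_zero {n : ℕ} {j : ℤ} {f : (Fin n → D.APlus N) → D.A N}
    (hf : f ∈ D.cocycles N n j) :
    (quad N D.rel).barDiff NIPath.toAlg (onLists D n f) = 0 := by
  rw [← onLists_diff (isMultilinear_of_mem hf.1), LinearMap.mem_ker.1 hf.2, map_zero]

/-- A cocycle that vanishes on reduced lists is a coboundary. -/
theorem mem_coboundaries {n : ℕ} {j : ℤ} {f : (Fin n → D.APlus N) → D.A N}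
    (hf : f ∈ D.cocycles N n j)
    (h0 : ∀ l, (quad N D.rel).Reduced l → onLists D n f l = 0) : f ∈ D.coboundaries N n j := by
  have hd := barDiff_onLists_eq_zero hf
  rcases n with _ | n
  -- In degree 0 the only list is empty, hence reduced, so the cocycle vanishes.
  · have : f = 0 := by
      refine onLists_injective (isMultilinear_of_mem hf.1) ⟨0, rfl⟩ ?_
      rw [map_zero]
      funext l
      rcases l with _ | ⟨p, l⟩
      · exact h0 [] ⟨by simp, List.isChain_nil⟩
      · exact onLists_of_ne _ (by simp)
    rw [this]
    exact zero_mem _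
  · have hG : (quad N D.rel).homotopy R NIPath.toAlg (onLists D (n + 1) f) ∈
        goodSpan N D n (n + (j + 1)) := by
      refine homotopy_mem_goodSpan ?_
      -- The gradings match because `(n + 1) + j = n + (j + 1)`.
      have := onLists_mem_goodSpan hf.1
      convert this using 2
      push_cast
      ring
    obtain ⟨g, hg, hgG⟩ := exists_bicochain hG
    refine ⟨g, hg, ?_⟩
    refine onLists_injective (isMultilinear_of_mem hg).diff (isMultilinear_of_mem hf.1) ?_
    rw [onLists_diff (isMultilinear_of_mem hg), hgG]
    exact (quad N D.rel).barDiff_homotopy Alg.add_self _ NIPath.toAlg_mul _ hd h0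

/-- The cohomology vanishes if no homogeneous cochain can be nonzero on reduced lists. -/
theorem subsingleton_H {n : ℕ} {j : ℤ}
    (h : ∀ l, (quad N D.rel).Reduced l → ∀ q e, ¬ Adm D n (n + j) l q e) :
    Subsingleton (D.H N n j) := by
  refine Submodule.Quotient.subsingleton_iff.2 ?_
  rw [eq_top_iff]
  rintro ⟨f, hf⟩ -
  refine mem_coboundaries hf fun l hl => ?_
  have := apply_mem_of_goodSpan (onLists_mem_goodSpan hf.1) l ⊥
    fun q e hq => (h l hl q e hq).elim
  simpa using this

end Hom


/-! ### Single generators. -/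

section Arrow

variable {N : ℕ} {r : Letter → Letter → Prop}

/-- A generator as a monomial. -/
def arrow (a : ZMod N × Letter) : NIPath N r :=
  ⟨⟨a.1, [a.2], List.isChain_singleton _⟩, List.cons_ne_nil _ _⟩

theorem arrow_injective : Function.Injective (arrow : ZMod N × Letter → NIPath N r) := by
  rintro ⟨i, x⟩ ⟨j, y⟩ h
  have h1 := congrArg (fun p : NIPath N r => p.1.start) h
  have h2 := congrArg (fun p : NIPath N r => p.1.word) h
  simp only [arrow, List.cons.injEq, and_true] at h1 h2
  rw [h1, h2]

theorem arrow_target (a : ZMod N × Letter) :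
    (arrow a : NIPath N r).1.target = a.2.next a.1 := rfl

theorem fac_arrow (a : ZMod N × Letter) : (quad N r).fac (arrow a) = none := rfl

theorem exists_arrow {p : NIPath N r} (h : (quad N r).fac p = none) : ∃ a, p = arrow a := by
  have h1 : p.1.word.length = 1 := NIPath.fac_eq_none.1 h
  obtain ⟨x, hx⟩ := List.length_eq_one_iff.1 h1
  exact ⟨(p.1.start, x), Subtype.ext (Path.ext rfl hx)⟩

theorem mul_arrow {a b : ZMod N × Letter} :
    (quad N r).mul (arrow a) (arrow b) = none ↔ (a.2.next a.1 = b.1 → ¬ r a.2 b.2) := by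
  refine NIPath.mul_eq_none.trans ?_
  simp [arrow, Path.target]

theorem arrow_mul_idem (a : ZMod N × Letter) (i : ZMod N) :
    (arrow a : NIPath N r).toAlg * Alg.idem i =
      if a.2.next a.1 = i then (arrow a : NIPath N r).toAlg else 0 :=
  basis_mul_idem i _

theorem idem_mul_arrow (a : ZMod N × Letter) (i : ZMod N) :
    Alg.idem i * (arrow a : NIPath N r).toAlg =
      if i = a.1 then (arrow a : NIPath N r).toAlg else 0 :=
  idem_mul_basis i _

end Arrow

/-! ### Cyclic words with vanishing consecutive products. -/

section Cyclic

variable {N : ℕ} {Z : Type*}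

/-- The list of `k` generators that starts with `arr z` and proceeds along `succ`. -/
def cyc (r : Letter → Letter → Prop) (arr : Z → ZMod N × Letter) (succ : Z → Z) :
    ℕ → Z → List (NIPath N r)
  | 0, _ => []
  | k + 1, z => arrow (arr z) :: cyc r arr succ k (succ z)

/-- A family of generators indexed by `Z` such that the generators that have zero product with, and
are composable to, a generator of the family on the left or on the right are given by the
transitive permutation `succ` of order `n` of the indices. -/
structure IsCyclic (r : Letter → Letter → Prop) (arr : Z → ZMod N × Letter) (succ : Z → Z)
    (n : ℕ) : Prop where
  injective : Function.Injective arr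
  left : ∀ z y, y.2.next y.1 = (arr z).1 → ¬ r y.2 (arr z).2 → ∃ z', arr z' = y ∧ succ z' = z
  right : ∀ z y, (arr z).2.next (arr z).1 = y.1 → ¬ r (arr z).2 y.2 → y = arr (succ z)
  next : ∀ z, (arr z).2.next (arr z).1 = (arr (succ z)).1
  not_rel : ∀ z, ¬ r (arr z).2 (arr (succ z)).2
  period : ∀ z, succ^[n] z = z
  trans : ∀ z z', ∃ k, succ^[k] z = z'

variable {r : Letter → Letter → Prop} {arr : Z → ZMod N × Letter} {succ : Z → Z} {n : ℕ}

theorem cyc_length (k : ℕ) (z : Z) : (cyc r arr succ k z).length = k := by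
  induction k generalizing z with
  | zero => rfl
  | succ k ih => simp [cyc, ih]

theorem cyc_succ' (k : ℕ) (z : Z) :
    cyc r arr succ (k + 1) z = cyc r arr succ k z ++ [arrow (arr (succ^[k] z))] := by
  induction k generalizing z with
  | zero => rfl
  | succ k ih => rw [cyc, ih]; rfl

theorem lettersList_cyc (k : ℕ) (z : Z) : lettersList (cyc r arr succ k z) = k := by
  induction k generalizing z with
  | zero => rfl
  | succ k ih =>
    rw [cyc, lettersList, List.map_cons, List.sum_cons, ← lettersList, ih, add_comm]
    rfl

theorem alexList_cyc (k : ℕ) (z : Z) : alexList (cyc r arr succ k z) =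
    ∑ i : Fin k, alexWord (arr (succ^[i] z)).1 [(arr (succ^[i] z)).2] := by
  induction k generalizing z with
  | zero => rfl
  | succ k ih =>
    rw [Fin.sum_univ_succ, cyc, alexList, List.map_cons, List.sum_cons, ← alexList, ih]
    rfl

namespace IsCyclic

variable (h : IsCyclic r arr succ n)
include h

theorem compat (k : ℕ) (z : Z) :
    Compat (arr z).1 (cyc r arr succ k z) (arr (succ^[k] z)).1 := by
  induction k generalizing z with
  | zero => rfl
  | succ k ih =>
    refine ⟨rfl, ?_⟩
    rw [arrow_target, h.next]
    exact ih (succ z)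

theorem reduced (k : ℕ) (z : Z) : (quad N r).Reduced (cyc r arr succ k z) := by
  induction k generalizing z with
  | zero => exact ⟨by simp [cyc], List.isChain_nil⟩
  | succ k ih =>
    refine ⟨?_, ?_⟩
    · simp only [cyc, List.mem_cons, forall_eq_or_imp]
      exact ⟨fac_arrow _, (ih _).1⟩
    · rw [cyc, List.isChain_cons]
      refine ⟨?_, (ih _).2⟩
      rcases k with _ | k
      · simp [cyc]
      · simp only [cyc, List.head?_cons, Option.mem_some_iff, forall_eq']
        exact mul_arrow.2 fun _ => h.not_rel z

theorem cyc_period (z : Z) :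
    cyc r arr succ n z ++ [arrow (arr z)] = arrow (arr z) :: cyc r arr succ n (succ z) := by
  have := cyc_succ' (r := r) (arr := arr) (succ := succ) n z
  rw [h.period] at this
  exact this.symm

/-- In a composable reduced list each generator of the family forces the next one, by `right`. -/
theorem eq_cyc (l : List (NIPath N r)) (z : Z) (k : ZMod N)
    (hl : (quad N r).Reduced (arrow (arr z) :: l))
    (hc : Compat (arr z).1 (arrow (arr z) :: l) k) :
    arrow (arr z) :: l = cyc r arr succ (l.length + 1) z := by
  induction l generalizing z with
  | nil => rfl
  | cons p l ih =>
    obtain ⟨y, rfl⟩ := exists_arrow (hl.1 p (by simp))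
    have h1 := mul_arrow.1 hl.2.rel
    have h2 : (arr z).2.next (arr z).1 = y.1 := hc.2.1.symm
    obtain rfl := h.right z y h2 (h1 h2)
    rw [cyc, List.length_cons, ← ih (succ z) hl.tail]
    have h3 := hc.2
    rw [arrow_target, h2] at h3
    exact h3

end IsCyclic

end Cyclic

/-! ### Rank one when only cyclic words contribute. -/

section Rank

variable {N : ℕ} {D : Datum} {Z : Type} {arr : Z → ZMod N × Letter} {succ : Z → Z} {m : ℕ}
  {c : ℤ} {e : Fin 2 →₀ ℕ}

/-- The value of a cocycle on the cyclic word starting at `z`, as a multiple of the idempotent. -/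
noncomputable def evalAt (N : ℕ) (D : Datum) {Z : Type} (arr : Z → ZMod N × Letter)
    (succ : Z → Z) (n : ℕ) (j : ℤ) (z : Z) : D.cocycles N n j →ₗ[R] R :=
  Alg.basis.coord (Path.idem (arr z).1) ∘ₗ LinearMap.proj (cyc D.rel arr succ n z) ∘ₗ
    onLists D n ∘ₗ (D.cocycles N n j).subtype

theorem evalAt_apply {n : ℕ} {j : ℤ} (z : Z) (f : D.cocycles N n j) :
    evalAt N D arr succ n j z f =
      Alg.basis.repr (onLists D n f.1 (cyc D.rel arr succ n z)) (Path.idem (arr z).1) := rfl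

theorem vMon_ne_zero (e : Fin 2 →₀ ℕ) : vMon e ≠ 0 := by
  rw [vMon, Ne, MvPolynomial.monomial_eq_zero]
  exact one_ne_zero

/-- The only terms in values of homogeneous cochains on reduced lists are the multiples by
`V₀ ^ e 0 * V_{N+1} ^ e 1` of the idempotents, on the cyclic words. -/
structure IsCyclicClass (D : Datum) (arr : Z → ZMod N × Letter) (succ : Z → Z) (n : ℕ) (c : ℤ)
    (e : Fin 2 →₀ ℕ) : Prop where
  adm : ∀ z, Adm D n c (cyc D.rel arr succ n z) (Path.idem (arr z).1) e
  eq_of_adm : ∀ l, (quad N D.rel).Reduced l → ∀ q e', Adm D n c l q e' →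
    e' = e ∧ q.word = [] ∧ ∃ z, l = cyc D.rel arr succ n z

variable (h : IsCyclic D.rel arr succ (m + 1)) (hc : IsCyclicClass D arr succ (m + 1) c e)
include h hc

theorem apply_cyc {F : List (NIPath N D.rel) → Alg N D.rel} (hF : F ∈ goodSpan N D (m + 1) c)
    (z : Z) : ∃ x : R, F (cyc D.rel arr succ (m + 1) z) = (x * vMon e) • Alg.idem (arr z).1 := by
  have := apply_mem_of_goodSpan hF (cyc D.rel arr succ (m + 1) z)
    (Submodule.span R {vMon e • Alg.idem (arr z).1}) fun q e' hq => by
      obtain ⟨rfl, h1, -⟩ := hc.eq_of_adm _ (h.reduced _ z) q e' hq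
      have h2 : q = Path.idem (arr z).1 := Path.ext hq.2.1.1.symm h1
      rw [h2]
      exact Submodule.mem_span_singleton_self _
  obtain ⟨x, hx⟩ := Submodule.mem_span_singleton.1 this
  exact ⟨x, by rw [← hx, smul_smul]⟩

omit h in
theorem apply_eq_zero {F : List (NIPath N D.rel) → Alg N D.rel} (hF : F ∈ goodSpan N D (m + 1) c)
    {l : List (NIPath N D.rel)} (hl : (quad N D.rel).Reduced l)
    (hz : ∀ z, l ≠ cyc D.rel arr succ (m + 1) z) : F l = 0 := by
  have := apply_mem_of_goodSpan hF l ⊥ fun q e' hq => by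
    obtain ⟨-, -, z, h2⟩ := hc.eq_of_adm _ hl q e' hq
    exact (hz z h2).elim
  simpa using this

/-- On the cyclic word with one extra letter the inner terms vanish, and the cocycle condition
equates the left multiple of the value at `succ z` with the right multiple of the value at `z`. -/
theorem apply_cyc_succ_eq_zero {F : List (NIPath N D.rel) → Alg N D.rel}
    (hF : F ∈ goodSpan N D (m + 1) c) (hd : (quad N D.rel).barDiff NIPath.toAlg F = 0) (z : Z)
    (hz : F (cyc D.rel arr succ (m + 1) z) = 0) :
    F (cyc D.rel arr succ (m + 1) (succ z)) = 0 := by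
  have h1 := congrFun hd (cyc D.rel arr succ (m + 1 + 1) z)
  have hR : QuadSystem.rightMul NIPath.toAlg F (cyc D.rel arr succ (m + 1 + 1) z) = 0 := by
    rw [cyc_succ', QuadSystem.rightMul_concat, hz, zero_mul]
  obtain ⟨x, hx⟩ := apply_cyc h hc hF (succ z)
  rw [QuadSystem.barDiff, QuadSystem.mergeSum_reduced _ (h.reduced _ z), QuadSystem.outer, hR,
    cyc, QuadSystem.leftMul, hx, mul_smul_comm, arrow_mul_idem, if_pos (h.next z)] at h1
  -- Multiplying an idempotent by a composable generator loses no information about its coefficient.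
  have h2 := congrArg (fun a => Alg.basis.repr a (arrow (r := D.rel) (arr z)).1) h1
  simp only [NIPath.toAlg, zero_add, add_zero, map_smul, Module.Basis.repr_self,
    Finsupp.smul_apply, Finsupp.single_eq_same, smul_eq_mul, mul_one, Pi.zero_apply, map_zero,
    Finsupp.zero_apply] at h2
  rw [hx, h2, zero_smul]

theorem reduced_eq_zero {F : List (NIPath N D.rel) → Alg N D.rel}
    (hF : F ∈ goodSpan N D (m + 1) c) (hd : (quad N D.rel).barDiff NIPath.toAlg F = 0) (z₀ : Z)
    (hz : F (cyc D.rel arr succ (m + 1) z₀) = 0) (l : List (NIPath N D.rel))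
    (hl : (quad N D.rel).Reduced l) : F l = 0 := by
  by_cases hz' : ∃ z, l = cyc D.rel arr succ (m + 1) z
  · obtain ⟨z, rfl⟩ := hz'
    obtain ⟨k, rfl⟩ := h.trans z₀ z
    induction k with
    | zero => exact hz
    | succ k ih =>
      rw [Function.iterate_succ_apply']
      exact apply_cyc_succ_eq_zero h hc hF hd _ (ih (h.reduced _ _))
  · push Not at hz'
    exact apply_eq_zero hc hF hl hz'

omit hc in
theorem cyc_injective {z z' : Z}
    (hz : cyc D.rel arr succ (m + 1) z = cyc D.rel arr succ (m + 1) z') : z = z' := by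
  rw [cyc, cyc, List.cons.injEq] at hz
  exact h.injective (arrow_injective hz.1)

-- The cochain with the same coefficient on all rotations has a differential vanishing on reduced
-- lists. Adding the homotopy of this differential makes it a cocycle without changing its values on
-- reduced lists.
open Classical in
theorem exists_cocycle (z₀ : Z) : ∃ F ∈ goodSpan N D (m + 1) c,
    (quad N D.rel).barDiff NIPath.toAlg F = 0 ∧
      F (cyc D.rel arr succ (m + 1) z₀) = vMon e • Alg.idem (arr z₀).1 := by
  let F : List (NIPath N D.rel) → Alg N D.rel := fun l =>
    if hl : ∃ z, l = cyc D.rel arr succ (m + 1) z then vMon e • Alg.idem (arr hl.choose).1 else 0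
  have hF1 : ∀ z, F (cyc D.rel arr succ (m + 1) z) = vMon e • Alg.idem (arr z).1 := by
    intro z
    have hl : ∃ z', cyc D.rel arr succ (m + 1) z = cyc D.rel arr succ (m + 1) z' := ⟨z, rfl⟩
    have h1 := cyc_injective h hl.choose_spec
    change dite _ _ _ = _
    rw [dif_pos hl, ← h1]
  have hF2 : ∀ l, (∀ z, l ≠ cyc D.rel arr succ (m + 1) z) → F l = 0 := fun l hl =>
    dif_neg fun ⟨z, hz⟩ => hl z hz
  have hF : Good D (m + 1) c F := by
    intro l
    by_cases hl : ∃ z, l = cyc D.rel arr succ (m + 1) z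
    · obtain ⟨z, rfl⟩ := hl
      rw [hF1]
      exact vMon_smul_mem (hc.adm z)
    · push Not at hl
      rw [hF2 l hl]
      exact zero_mem _
  -- A nonzero outer term on a reduced list needs a generator composable with a cyclic word;
  -- reducedness then makes it the cyclic predecessor here, and the cyclic successor in `hR`, so the
  -- whole list is cyclic.
  have hL : ∀ l, (quad N D.rel).Reduced l → (∀ z, l ≠ cyc D.rel arr succ (m + 1 + 1) z) →
      QuadSystem.leftMul NIPath.toAlg F l = 0 := by
    intro l hl hz
    rcases l with _ | ⟨p, l⟩
    · rfl
    obtain ⟨y, rfl⟩ := exists_arrow (hl.1 p (by simp))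
    rw [QuadSystem.leftMul]
    by_cases hl' : ∃ z, l = cyc D.rel arr succ (m + 1) z
    · obtain ⟨z, rfl⟩ := hl'
      rw [hF1, mul_smul_comm, arrow_mul_idem, if_neg, smul_zero]
      intro hy
      obtain ⟨z', rfl, rfl⟩ := h.left z y hy (mul_arrow.1 hl.2.rel hy)
      exact hz z' rfl
    · push Not at hl'
      rw [hF2 l hl', mul_zero]
  have hR : ∀ l, (quad N D.rel).Reduced l → (∀ z, l ≠ cyc D.rel arr succ (m + 1 + 1) z) →
      QuadSystem.rightMul NIPath.toAlg F l = 0 := by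
    intro l hl hz
    rcases List.eq_nil_or_concat' l with rfl | ⟨l, p, rfl⟩
    · rfl
    obtain ⟨y, rfl⟩ := exists_arrow (hl.1 p (by simp))
    rw [QuadSystem.rightMul_concat]
    by_cases hl' : ∃ z, l = cyc D.rel arr succ (m + 1) z
    · obtain ⟨z, rfl⟩ := hl'
      rw [hF1, smul_mul_assoc, idem_mul_arrow, if_neg, smul_zero]
      intro hy
      have h1 := h.period z
      rw [Function.iterate_succ_apply'] at h1
      have h2 := h.next (succ^[m] z)
      rw [h1, hy] at h2
      have h3 := hl.2
      rw [cyc_succ', List.append_assoc] at h3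
      have h4 := mul_arrow.1 h3.right_of_append.rel h2
      have h5 := h.right _ y h2 h4
      rw [h1] at h5
      refine hz z ?_
      rw [h5, h.cyc_period]
      rfl
    · push Not at hl'
      rw [hF2 l hl', zero_mul]
  have hB : ∀ l, (quad N D.rel).Reduced l → (quad N D.rel).barDiff NIPath.toAlg F l = 0 := by
    intro l hl
    rw [QuadSystem.barDiff, QuadSystem.mergeSum_reduced _ hl, zero_add, QuadSystem.outer]
    by_cases hl' : ∃ z, l = cyc D.rel arr succ (m + 1 + 1) z
    · obtain ⟨z, rfl⟩ := hl'
      have h1 : cyc D.rel arr succ (m + 1 + 1) z =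
          arrow (arr z) :: cyc D.rel arr succ (m + 1) (succ z) := rfl
      have h2 : QuadSystem.leftMul NIPath.toAlg F (cyc D.rel arr succ (m + 1 + 1) z) =
          vMon e • (arrow (r := D.rel) (arr z)).toAlg := by
        rw [h1, QuadSystem.leftMul, hF1, mul_smul_comm, arrow_mul_idem, if_pos (h.next z)]
      have h3 : QuadSystem.rightMul NIPath.toAlg F (cyc D.rel arr succ (m + 1 + 1) z) =
          vMon e • (arrow (r := D.rel) (arr z)).toAlg := by
        rw [h1, ← h.cyc_period, QuadSystem.rightMul_concat, hF1, smul_mul_assoc, idem_mul_arrow,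
          if_pos rfl]
      -- By periodicity the prolonged word begins and ends with the same generator, so the two outer
      -- terms agree.
      rw [h2, h3, Alg.add_self]
    · push Not at hl'
      rw [hL l hl hl', hR l hl hl', add_zero]
  have hFd := (quad N D.rel).barDiff_homotopy (K := R) Alg.add_self _ NIPath.toAlg_mul _
    ((quad N D.rel).barDiff_barDiff Alg.add_self _ NIPath.toAlg_mul F) hB
  refine ⟨F + (quad N D.rel).homotopy R NIPath.toAlg ((quad N D.rel).barDiff NIPath.toAlg F),
    Submodule.subset_span (hF.add hF.barDiff.homotopy), ?_, ?_⟩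
  · refine (((quad N D.rel).barDiffLin R NIPath.toAlg).map_add _ _).trans ?_
    change (quad N D.rel).barDiff NIPath.toAlg F + (quad N D.rel).barDiff NIPath.toAlg _ = 0
    rw [hFd]
    funext l
    exact Alg.add_self _
  · rw [Pi.add_apply, hF1, (quad N D.rel).homotopy_reduced _ _ (h.reduced _ _), add_zero]

/-- Evaluation at one cyclic word has the coboundaries as kernel and the ideal generated by `vMon e`
as range. This ideal is free of rank one, since `vMon e` is nonzero in a domain. -/
theorem nonempty_H_equiv {j : ℤ} (hj : ((m + 1 : ℕ) : ℤ) + j = c) (z₀ : Z)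
    (hm : ∀ l, (quad N D.rel).Reduced l → ∀ q e, ¬ Adm D m c l q e) :
    Nonempty (D.H N (m + 1) j ≃ₗ[R] R) := by
  subst hj
  have hker : (D.coboundaries N (m + 1) j).submoduleOf (D.cocycles N (m + 1) j) =
      LinearMap.ker (evalAt N D arr succ (m + 1) j z₀) := by
    ext ⟨f, hf⟩
    rw [LinearMap.mem_ker, evalAt_apply]
    change f ∈ D.coboundaries N (m + 1) j ↔ _
    have hF := onLists_mem_goodSpan hf.1
    constructor
    · rintro ⟨g, hg, hgf⟩
      have hgG := onLists_mem_goodSpan hg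
      -- By `hm`, cochains in degree `m` cannot be nonzero on reduced lists, so neither can their
      -- coboundaries.
      have hg0 : ∀ l, (quad N D.rel).Reduced l → onLists D m g l = 0 := by
        intro l hl
        have := apply_mem_of_goodSpan hgG l ⊥ fun q e hq => by
          refine (hm l hl q e ?_).elim
          convert hq using 1
          push_cast
          ring
        simpa using this
      have h1 : onLists D (m + 1) f = _ :=
        (congrArg _ hgf.symm).trans (onLists_diff (isMultilinear_of_mem hg))
      rw [h1, QuadSystem.barDiff, QuadSystem.mergeSum_reduced _ (h.reduced _ _),
        QuadSystem.outer_reduced _ hg0 (h.reduced _ _), add_zero, map_zero, Finsupp.zero_apply]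
    · intro h0
      refine mem_coboundaries hf
        (reduced_eq_zero h hc hF (barDiff_onLists_eq_zero hf) z₀ ?_)
      obtain ⟨x, hx⟩ := apply_cyc h hc hF z₀
      rw [hx, map_smul, Finsupp.smul_apply, Alg.idem, Module.Basis.repr_self,
        Finsupp.single_eq_same, smul_eq_mul, mul_one] at h0
      rw [hx, h0, zero_smul]
  have hrange : LinearMap.range (evalAt N D arr succ (m + 1) j z₀) =
      Submodule.span R {vMon e} := by
    apply le_antisymm
    · rintro _ ⟨⟨f, hf⟩, rfl⟩
      obtain ⟨x, hx⟩ := apply_cyc h hc (onLists_mem_goodSpan hf.1) z₀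
      rw [evalAt_apply, hx, map_smul, Finsupp.smul_apply, Alg.idem, Module.Basis.repr_self,
        Finsupp.single_eq_same, smul_eq_mul, mul_one]
      exact Submodule.mem_span_singleton.2 ⟨x, rfl⟩
    · rw [Submodule.span_singleton_le_iff_mem]
      obtain ⟨F, hF, hd, hFz⟩ := exists_cocycle h hc z₀
      obtain ⟨f, hf, rfl⟩ := exists_bicochain hF
      have hm := isMultilinear_of_mem hf
      have hdf : D.diff N (m + 1) f = 0 := by
        refine onLists_injective hm.diff ⟨0, rfl⟩ ?_
        rw [onLists_diff hm, hd, map_zero]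
      refine ⟨⟨f, hf, hdf⟩, ?_⟩
      rw [evalAt_apply, hFz, map_smul, Finsupp.smul_apply, Alg.idem, Module.Basis.repr_self,
        Finsupp.single_eq_same, smul_eq_mul, mul_one]
  exact ⟨(Submodule.quotEquivOfEq _ _ hker).trans
    ((evalAt N D arr succ (m + 1) j z₀).quotKerEquivRange.trans
      ((LinearEquiv.ofEq _ _ hrange).trans
        (LinearEquiv.toSpanNonzeroSingleton R R (vMon e) (vMon_ne_zero e)).symm))⟩

end Rank


/-! ### Counting loops and steps. -/

section Counting

variable {N : ℕ}

/-- The number of generators of kind `loop`. -/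
def loops : List Letter → ℕ
  | [] => 0
  | .loop :: w => loops w + 1
  | .step :: w => loops w

/-- The number of generators of kind `step`. -/
def steps : List Letter → ℕ
  | [] => 0
  | .loop :: w => steps w
  | .step :: w => steps w + 1

theorem loops_add_steps (w : List Letter) : loops w + steps w = w.length := by
  induction w with
  | nil => rfl
  | cons x w ih => cases x <;> simp only [loops, steps, List.length_cons] <;> omega

theorem loops_append (v w : List Letter) : loops (v ++ w) = loops v + loops w := by
  induction v with
  | nil => simp [loops]
  | cons x v ih =>
    cases x
    case loop => simp only [loops, List.cons_append, ih]; omega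
    case step => simp only [loops, List.cons_append, ih]

theorem steps_append (v w : List Letter) : steps (v ++ w) = steps v + steps w := by
  induction v with
  | nil => simp [steps]
  | cons x v ih =>
    cases x
    case loop => simp only [steps, List.cons_append, ih]
    case step => simp only [steps, List.cons_append, ih]; omega

/-- In an alternating word the two counts differ by at most one; the refinement by the first letter
is what the induction needs. -/
theorem loops_steps_of_isChain_ne {w : List Letter} (h : w.IsChain (· ≠ ·)) :
    (loops w ≤ steps w + 1 ∧ steps w ≤ loops w + 1) ∧
      (∀ x ∈ w.head?, x = Letter.loop → steps w ≤ loops w) ∧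
        ∀ x ∈ w.head?, x = Letter.step → loops w ≤ steps w := by
  induction w with
  | nil => simp [loops, steps]
  | cons x w ih =>
    rw [List.isChain_cons] at h
    obtain ⟨h1, h2, h3⟩ := ih h.2
    rcases w with _ | ⟨y, w⟩
    · cases x <;> simp [loops, steps]
    have h4 := h.1 y (by simp)
    simp only [List.head?_cons, Option.mem_some_iff, forall_eq'] at h2 h3 ⊢
    cases x <;> cases y <;> simp_all [loops, steps] <;> omega

theorem loops_steps_of_isChain_eq {w : List Letter} (h : w.IsChain (· = ·)) :
    loops w = 0 ∨ steps w = 0 := by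
  have : (∀ x ∈ w.head?, x = Letter.loop → steps w = 0) ∧
      ∀ x ∈ w.head?, x = Letter.step → loops w = 0 := by
    induction w with
    | nil => simp
    | cons x w ih =>
      rw [List.isChain_cons] at h
      obtain ⟨h2, h3⟩ := ih h.2
      rcases w with _ | ⟨y, w⟩
      · cases x <;> simp [loops, steps]
      have h4 := h.1 y (by simp)
      subst h4
      simp only [List.head?_cons, Option.mem_some_iff, forall_eq'] at h2 h3 ⊢
      cases x <;> simp_all [loops, steps]
  rcases w with _ | ⟨x, w⟩
  · exact Or.inl rfl
  · cases x
    · exact Or.inr (this.1 _ (by simp) rfl)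
    · exact Or.inl (this.2 _ (by simp) rfl)

/-- The letters that occur in a list of monomials. -/
def letters {r : Letter → Letter → Prop} (l : List (NIPath N r)) : List Letter :=
  l.flatMap fun p => p.1.word

theorem letters_length {r : Letter → Letter → Prop} (l : List (NIPath N r)) :
    (letters l).length = lettersList l := List.length_flatMap

/-- Consecutive entries are composable, so their products vanish because of the relations and not
because of mismatched idempotents. -/
theorem letters_reduced {r : Letter → Letter → Prop} {l : List (NIPath N r)}
    (h : (quad N r).Reduced l) {i k : ZMod N} (hc : Compat i l k) :
    (letters l).length = l.length ∧ (letters l).IsChain fun x y => ¬ r x y := by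
  induction l generalizing i with
  | nil => exact ⟨rfl, List.isChain_nil⟩
  | cons p l ih =>
    obtain ⟨h1, h2⟩ := ih h.tail hc.2
    obtain ⟨a, rfl⟩ := exists_arrow (h.1 p (by simp))
    have h3 : letters (arrow a :: l) = a.2 :: letters l := rfl
    rw [h3, List.length_cons, List.length_cons, h1, List.isChain_cons]
    refine ⟨rfl, ?_, h2⟩
    rcases l with _ | ⟨q, l⟩
    · simp [letters]
    · obtain ⟨b, rfl⟩ := exists_arrow (h.1 q (by simp))
      have h4 : letters (arrow b :: l) = b.2 :: letters l := rfl
      rw [h4]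
      simp only [List.head?_cons, Option.mem_some_iff, forall_eq']
      exact mul_arrow.1 h.2.rel hc.2.1.symm

variable [NeZero N]

/-- The total coefficient of the generators `(i, x)` for fixed `x`. -/
def total (x : Letter) : AlexGroup N →+ ℤ where
  toFun α := ∑ i, α (i, x)
  map_zero' := by simp
  map_add' α β := by simp [Finset.sum_add_distrib]

theorem total_alexWord (i : ZMod N) (w : List Letter) :
    total .loop (alexWord i w) = loops w ∧ total .step (alexWord i w) = steps w := by
  classical
  induction w generalizing i with
  | nil => simp [alexWord, loops, steps]
  | cons x w ih =>
    obtain ⟨h1, h2⟩ := ih (x.next i)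
    have h3 : ∀ x y : Letter, total y (Pi.single (i, x) 1 : AlexGroup N) =
        if x = y then 1 else 0 := by
      intro x y
      change ∑ j, (Pi.single (i, x) 1 : AlexGroup N) (j, y) = _
      simp only [Pi.single_apply, Prod.mk.injEq]
      by_cases hx : x = y
      · subst hx; simp
      · simp [hx, Ne.symm hx]
    have h4 : alexWord i (x :: w) = Pi.single (i, x) 1 + alexWord (x.next i) w := by
      rw [alexWord]
    rw [h4, map_add, map_add, h1, h2, h3, h3]
    cases x <;> simp [loops, steps, add_comm]

theorem total_alexList {r : Letter → Letter → Prop} (l : List (NIPath N r)) :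
    total .loop (alexList l) = loops (letters l) ∧
      total .step (alexList l) = steps (letters l) := by
  induction l with
  | nil => simp [alexList, letters, loops, steps]
  | cons p l ih =>
    have h1 : alexList (p :: l) = alexWord p.1.start p.1.word + alexList l := rfl
    have h2 : letters (p :: l) = p.1.word ++ letters l := rfl
    obtain ⟨h3, h4⟩ := total_alexWord p.1.start p.1.word
    rw [h1, h2, map_add, map_add, h3, h4, ih.1, ih.2, loops_append, steps_append]
    push_cast
    exact ⟨rfl, rfl⟩

theorem total_alexCoeff (e : Fin 2 →₀ ℕ) :
    total (N := N) .loop (alexCoeff e) = N * e 0 ∧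
      total (N := N) .step (alexCoeff e) = N * (e 0 + e 1) := by
  constructor
  · change ∑ i : ZMod N, (e 0 : ℤ) = _
    simp
  · change ∑ i : ZMod N, (e 0 + e 1 : ℤ) = _
    simp

/-- Summing the Alexander grading over `ZMod N` forgets positions: `V₀` contributes `N` loops and
`N` steps, and `V_{N+1}` contributes `N` steps. -/
theorem Adm.total {D : Datum} {n : ℕ} {c : ℤ} {l : List (NIPath N D.rel)} {q : Path N D.rel}
    {e : Fin 2 →₀ ℕ} (h : Adm D n c l q e) :
    (N * e 0 + loops q.word : ℤ) = loops (letters l) ∧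
      (N * (e 0 + e 1) + steps q.word : ℤ) = steps (letters l) := by
  have h1 := congrArg (StarAlg.total .loop) h.2.2.1
  have h2 := congrArg (StarAlg.total .step) h.2.2.1
  rw [map_add, (total_alexCoeff e).1, (total_alexWord _ _).1, (total_alexList l).1] at h1
  rw [map_add, (total_alexCoeff e).2, (total_alexWord _ _).2, (total_alexList l).2] at h2
  exact ⟨h1, h2⟩

-- By transitivity and the count of indices, one turn of the cycle meets every generator of the
-- family exactly once.
omit [NeZero N] in
theorem alexList_cyc_eq_sum {Z : Type*} [Fintype Z] {r : Letter → Letter → Prop}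
    {arr : Z → ZMod N × Letter} {succ : Z → Z} {n : ℕ} (h : IsCyclic r arr succ n) (hn : n ≠ 0)
    (hZ : Fintype.card Z = n) (z : Z) :
    alexList (cyc r arr succ n z) = ∑ z, alexWord (arr z).1 [(arr z).2] := by
  rw [alexList_cyc]
  refine Function.Bijective.sum_comp (e := fun i : Fin n => succ^[i] z) ?_
    fun z => alexWord (arr z).1 [(arr z).2]
  rw [Fintype.bijective_iff_surjective_and_card]
  refine ⟨fun z' => ?_, by simp [hZ]⟩
  obtain ⟨k, rfl⟩ := h.trans z z'
  refine ⟨⟨k % n, Nat.mod_lt _ (Nat.pos_of_ne_zero hn)⟩, ?_⟩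
  exact (Function.IsPeriodicPt.iterate_mod_apply (h.period z) k)

end Counting

/-! ### The two algebras: degree counts and cyclic words. -/

section Algebras

variable {N : ℕ}

/-- Here `a`, `b` count the loops and steps of the list, `a'`, `b'` those of the value, and `x`, `y`
are the exponents. Eliminating `n` leaves `2x + (N-2)y + a' + b' = -j`, which has few solutions; the
balance of `a` and `b` rules out `y > 0`, and for `j = -2` also `x = y = 0`. -/
theorem datumA_arith (hN : 2 < N) {n a b a' b' x y : ℕ} {j : ℤ} (hj : j = -1 ∨ j = -2)
    (h3 : a ≤ b + 1 ∧ b ≤ a + 1) (h4 : a' = 0 ∨ b' = 0) (h5 : (N * x + a' : ℤ) = a)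
    (h6 : (N * (x + y) + b' : ℤ) = b) (h7 : x * (2 * (N : ℤ) - 2) + y * 2 = n + j)
    (h8 : a + b = n) :
    (j = -1 → n = 1) ∧ (j = -2 → n = 2 * N ∧ x = 1 ∧ y = 0 ∧ a' + b' = 0) := by
  -- With this substitution the coefficient `N - 2` of `y` becomes `M + 1`, which is positive and
  -- bounds `y`.
  obtain ⟨M, rfl⟩ : ∃ M, N = M + 3 := ⟨N - 3, by omega⟩
  push_cast at h5 h6 h7
  have hs : 2 * (x : ℤ) + (M + 1) * y + a' + b' = -j := by
    have : (n : ℤ) = a + b := by exact_mod_cast h8.symm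
    linear_combination h5 + h6 - h7 - this
  have hMy : (0 : ℤ) ≤ M * y := by positivity
  have hx : x ≤ 1 := by zify; rcases hj with rfl | rfl <;> linarith
  have hy : y ≤ 2 := by zify; rcases hj with rfl | rfl <;> linarith
  clear hMy
  interval_cases x <;> interval_cases y <;> push_cast at h5 h6 h7 hs <;> omega

/-- Since `a` or `b` is zero, so is `x`; the Maslov grading then reads `2y + a' + b' = -j`. The case
`y = 0`, `j = -2` would need one loop and one step in the value, hence in the list, contradicting
`h3`. -/
theorem datumB_arith (hN : 2 < N) {n a b a' b' x y : ℕ} {j : ℤ} (hj : j = -1 ∨ j = -2)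
    (h3 : a = 0 ∨ b = 0) (h4 : a' ≤ b' + 1 ∧ b' ≤ a' + 1) (h5 : (N * x + a' : ℤ) = a)
    (h6 : (N * (x + y) + b' : ℤ) = b)
    (h7 : x * (2 * (N : ℤ) - 2) + y * -2 + ((a' + b' : ℕ) : ℤ) * -1 = (n : ℤ) * -1 + (n + j))
    (h8 : a + b = n) :
    (j = -1 → n = 1) ∧ (j = -2 → n = N ∧ x = 0 ∧ y = 1 ∧ a' + b' = 0 ∧ a = 0) := by
  obtain ⟨M, rfl⟩ : ∃ M, N = M + 3 := ⟨N - 3, by omega⟩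
  have hMx : (0 : ℤ) ≤ M * x := by positivity
  have hMy : (0 : ℤ) ≤ M * y := by positivity
  push_cast at h5 h6 h7
  have hx : x = 0 := by
    rcases h3 with rfl | rfl
    · zify; push_cast at h5; linarith
    · zify; push_cast at h6; linarith
  subst hx
  have hy : y ≤ 1 := by
    push_cast at h7
    zify; rcases hj with rfl | rfl <;> linarith
  clear hMx hMy
  interval_cases y <;> push_cast at h5 h6 h7 <;> omega

theorem datumA_adm (hN : 2 < N) {n : ℕ} {j : ℤ} (hj : j = -1 ∨ j = -2)
    {l : List (NIPath N (datumA N).rel)} (hl : (quad N (datumA N).rel).Reduced l)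
    {q : Path N (datumA N).rel} {e : Fin 2 →₀ ℕ} (h : Adm (datumA N) n (n + j) l q e) :
    (j = -1 → n = 1) ∧ (j = -2 → n = 2 * N ∧ e 0 = 1 ∧ e 1 = 0 ∧ q.word = []) := by
  have : NeZero N := ⟨by omega⟩
  obtain ⟨h1, h2⟩ := letters_reduced hl h.2.1
  obtain ⟨h3, -⟩ := loops_steps_of_isChain_ne (w := letters l) h2
  have h4 := loops_steps_of_isChain_eq (w := q.word) q.chain
  obtain ⟨h5, h6⟩ := h.total
  have h7 := h.2.2.2
  have h8 := loops_add_steps (letters l)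
  have h9 := loops_add_steps q.word
  rw [h1, h.1] at h8
  simp only [datumA, Matrix.cons_val_zero, Matrix.cons_val_one, mul_zero, add_zero, zero_add] at h7
  rw [← List.length_eq_zero_iff, ← h9]
  exact datumA_arith hN hj h3 h4 h5 h6 h7 h8

theorem datumB_adm (hN : 2 < N) {n : ℕ} {j : ℤ} (hj : j = -1 ∨ j = -2)
    {l : List (NIPath N (datumB N).rel)} (hl : (quad N (datumB N).rel).Reduced l)
    {q : Path N (datumB N).rel} {e : Fin 2 →₀ ℕ} (h : Adm (datumB N) n (n + j) l q e) :
    (j = -1 → n = 1) ∧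
      (j = -2 → n = N ∧ e 0 = 0 ∧ e 1 = 1 ∧ q.word = [] ∧ loops (letters l) = 0) := by
  have : NeZero N := ⟨by omega⟩
  obtain ⟨h1, h2⟩ := letters_reduced hl h.2.1
  have h3 := loops_steps_of_isChain_eq (w := letters l) (h2.imp fun x y hxy => not_not.1 hxy)
  obtain ⟨h4, -⟩ := loops_steps_of_isChain_ne (w := q.word) q.chain
  obtain ⟨h5, h6⟩ := h.total
  have h7 := h.2.2.2
  have h8 := loops_add_steps (letters l)
  have h9 := loops_add_steps q.word
  rw [← letters_length, h1, h.1, ← h9] at h7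
  rw [h1, h.1] at h8
  simp only [datumB, Matrix.cons_val_zero, Matrix.cons_val_one] at h7
  rw [← List.length_eq_zero_iff, ← h9]
  exact datumB_arith hN hj h3 h4 h5 h6 h7 h8

/-- The generator that follows a given one in the cyclic order `U₁, s₁, U₂, s₂, …`. -/
def nextArrow : ZMod N × Letter → ZMod N × Letter
  | (i, .loop) => (i, .step)
  | (i, .step) => (i + 1, .loop)

theorem nextArrow_iterate (k : ℕ) (a : ZMod N × Letter) :
    nextArrow^[2 * k] a = (a.1 + k, a.2) := by
  induction k with
  | zero => simp
  | succ k ih =>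
    rw [show 2 * (k + 1) = (2 * k + 1) + 1 by ring, Function.iterate_succ_apply',
      Function.iterate_succ_apply', ih]
    rcases a with ⟨i, _ | _⟩ <;> simp [nextArrow] <;> ring

theorem datumA_isCyclic [NeZero N] : IsCyclic (N := N) (datumA N).rel id nextArrow (2 * N) where
  injective := Function.injective_id
  left := by
    rintro ⟨i, _ | _⟩ ⟨j, _ | _⟩ h1 h2
    · exact (h2 rfl).elim
    · exact ⟨_, rfl, by simpa [nextArrow, Letter.next] using h1⟩
    · exact ⟨_, rfl, by simpa [nextArrow, Letter.next] using h1⟩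
    · exact (h2 rfl).elim
  right := by
    rintro ⟨i, _ | _⟩ ⟨j, _ | _⟩ h1 h2
    · exact (h2 rfl).elim
    · simpa [nextArrow, Letter.next] using h1.symm
    · simpa [nextArrow, Letter.next] using h1.symm
    · exact (h2 rfl).elim
  next := by rintro ⟨i, _ | _⟩ <;> rfl
  not_rel := by rintro ⟨i, _ | _⟩ <;> simp [datumA, nextArrow]
  period z := by rw [nextArrow_iterate]; simp
  trans := by
    have h : ∀ i j x, ∃ k, nextArrow^[k] ((i, x) : ZMod N × Letter) = (j, x) := fun i j x =>
      ⟨2 * (j - i).val, by rw [nextArrow_iterate]; simp⟩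
    rintro ⟨i, x⟩ ⟨j, y⟩
    by_cases hxy : x = y
    · exact hxy ▸ h i j x
    -- The target is reached through its predecessor in the cycle, which has the same kind as the
    -- starting generator.
    · obtain ⟨k, hk⟩ := h i (match x with | .loop => j | .step => j - 1) x
      refine ⟨k + 1, ?_⟩
      rw [Function.iterate_succ_apply', hk]
      cases x <;> cases y <;> simp_all [nextArrow] <;> exact (hxy rfl).elim

theorem datumB_isCyclic [NeZero N] :
    IsCyclic (datumB N).rel (fun i : ZMod N => (i, Letter.step)) (· + 1) N where
  injective i j h := (Prod.mk.inj h).1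
  left := by
    rintro i ⟨j, _ | _⟩ h1 h2
    · exact (h2 (by simp [datumB])).elim
    · exact ⟨j, rfl, h1⟩
  right := by
    rintro i ⟨j, _ | _⟩ h1 h2
    · exact (h2 (by simp [datumB])).elim
    · exact Prod.ext h1.symm rfl
  next _ := rfl
  not_rel _ := by simp [datumB]
  period z := by rw [add_right_iterate]; simp
  trans i j := ⟨(j - i).val, by rw [add_right_iterate]; simp⟩

instance : DecidableEq Letter
  | .loop, .loop => isTrue rfl
  | .step, .step => isTrue rfl
  | .loop, .step => isFalse nofun
  | .step, .loop => isFalse nofun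

instance : Fintype Letter := ⟨{.loop, .step}, fun x => by cases x <;> simp⟩

theorem alexWord_singleton (i : ZMod N) (x : Letter) :
    alexWord i [x] = Pi.single (i, x) 1 := by
  rw [alexWord, alexWord, add_zero]
  congr!

/-- One turn through all generators has the Alexander grading of `V₀`, and `2N - 2` is its Maslov
grading. -/
theorem datumA_isCyclicClass (hN : 2 < N) :
    IsCyclicClass (N := N) (datumA N) id nextArrow (2 * N) (2 * N - 2) (Finsupp.single 0 1) := by
  have : NeZero N := ⟨by omega⟩
  refine ⟨fun z => ⟨cyc_length _ _, ?_, ?_, ?_⟩, fun l hl q e h => ?_⟩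
  · have := datumA_isCyclic.compat (2 * N) z
    rwa [datumA_isCyclic.period] at this
  · rw [alexList_cyc_eq_sum datumA_isCyclic (by omega)
      (by rw [Fintype.card_prod, ZMod.card, mul_comm]; rfl)]
    simp only [alexWord_singleton, id]
    funext ⟨i, x⟩
    rw [Finset.sum_apply]
    simp only [Pi.single_apply]
    cases x <;> simp [alexCoeff, Path.idem, alexWord]
  · rw [lettersList_cyc]
    simp [datumA, Path.idem]
  · have h' : Adm (datumA N) (2 * N) ((2 * N : ℕ) + (-2)) l q e := by
      convert h using 1; push_cast; ring
    obtain ⟨-, h1, h2, h3⟩ := (datumA_adm hN (Or.inr rfl) hl h').2 rfl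
    refine ⟨?_, h3, ?_⟩
    · ext i; fin_cases i <;> simp [h1, h2]
    · rcases l with _ | ⟨p, l⟩
      · have := h.1; simp at this; omega
      · obtain ⟨a, rfl⟩ := exists_arrow (hl.1 p (by simp))
        refine ⟨a, ?_⟩
        have h4 := h.2.1
        have h5 := h4.1
        rw [← h5] at h4
        have := datumA_isCyclic.eq_cyc l a _ hl h4
        rw [← h.1]
        exact this

/-- One turn through the `σ_i` has the Alexander grading of `V_{N+1}`; its `N` letters have Maslov
grading `-N`, and `-N + (N - 2) = -2` is that of `V_{N+1}`. -/
theorem datumB_isCyclicClass (hN : 2 < N) :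
    IsCyclicClass (datumB N) (fun i : ZMod N => (i, Letter.step)) (· + 1) N (N - 2)
      (Finsupp.single 1 1) := by
  have : NeZero N := ⟨by omega⟩
  refine ⟨fun z => ⟨cyc_length _ _, ?_, ?_, ?_⟩, fun l hl q e h => ?_⟩
  · have := datumB_isCyclic.compat N z
    rwa [datumB_isCyclic.period] at this
  · rw [alexList_cyc_eq_sum datumB_isCyclic (by omega) (ZMod.card N)]
    simp only [alexWord_singleton]
    funext ⟨i, x⟩
    rw [Finset.sum_apply]
    simp only [Pi.single_apply]
    cases x <;> simp [alexCoeff, Path.idem, alexWord]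
  · rw [lettersList_cyc]
    simp only [datumB, Path.idem, Matrix.cons_val_zero, Matrix.cons_val_one, List.length_nil]
    simp
    ring
  · have h' : Adm (datumB N) N ((N : ℕ) + (-2)) l q e := h
    obtain ⟨-, h1, h2, h3, h6⟩ := (datumB_adm hN (Or.inr rfl) hl h').2 rfl
    refine ⟨?_, h3, ?_⟩
    · ext i; fin_cases i <;> simp [h1, h2]
    · rcases l with _ | ⟨p, l⟩
      · have := h.1; simp at this; omega
      · obtain ⟨⟨i, _ | _⟩, rfl⟩ := exists_arrow (hl.1 p (by simp))
        · have : loops (letters (arrow (i, Letter.loop) :: l)) = loops (letters l) + 1 := rfl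
          omega
        · refine ⟨i, ?_⟩
          have h4 := h.2.1
          have h5 := h4.1
          rw [← h5] at h4
          have := datumB_isCyclic.eq_cyc l i _ hl h4
          rwa [show l.length + 1 = N from h.1] at this

end Algebras

end StarAlg

theorem proposition5p4 (N : ℕ) (hN : 2 < N) :
    (Nonempty ((StarAlg.datumA N).H N (2 * N) (-2) ≃ₗ[StarAlg.R] StarAlg.R) ∧
      (∀ n : ℕ, n ≠ 2 * N → Subsingleton ((StarAlg.datumA N).H N n (-2)))) ∧
    (∀ n : ℕ, 2 ≤ n → Subsingleton ((StarAlg.datumA N).H N n (-1))) ∧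
    (Nonempty ((StarAlg.datumB N).H N N (-2) ≃ₗ[StarAlg.R] StarAlg.R) ∧
      (∀ n : ℕ, n ≠ N → Subsingleton ((StarAlg.datumB N).H N n (-2)))) ∧
    (∀ n : ℕ, n ≠ 1 → Subsingleton ((StarAlg.datumB N).H N n (-1))) := by
  have : NeZero N := ⟨by omega⟩
  refine ⟨⟨?_, fun n hn => StarAlg.subsingleton_H fun l hl q e h => ?_⟩,
    fun n hn => StarAlg.subsingleton_H fun l hl q e h => ?_,
    ⟨?_, fun n hn => StarAlg.subsingleton_H fun l hl q e h => ?_⟩,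
    fun n hn => StarAlg.subsingleton_H fun l hl q e h => ?_⟩
  · obtain ⟨m, hm⟩ : ∃ m, 2 * N = m + 1 := ⟨2 * N - 1, by omega⟩
    have h1 := StarAlg.datumA_isCyclic (N := N)
    have h2 := StarAlg.datumA_isCyclicClass hN
    have hm' : (2 * (N : ℤ)) = m + 1 := by exact_mod_cast hm
    rw [hm] at h1 h2 ⊢
    rw [hm'] at h2
    refine StarAlg.nonempty_H_equiv h1 h2 (by push_cast; ring) (0, .loop) fun l hl q e h => ?_
    -- Cochains one degree lower have `j = -1`, where only degree 1 can be nonzero on reduced lists,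
    -- and `m = 2N - 1 > 1`.
    have h' : StarAlg.Adm (StarAlg.datumA N) m ((m : ℕ) + (-1)) l q e := by
      convert h using 1; ring
    have := (StarAlg.datumA_adm hN (Or.inl rfl) hl h').1 rfl
    omega
  · exact hn ((StarAlg.datumA_adm hN (Or.inr rfl) hl h).2 rfl).1
  · have := (StarAlg.datumA_adm hN (Or.inl rfl) hl h).1 rfl
    omega
  · obtain ⟨m, hm⟩ : ∃ m, N = m + 1 := ⟨N - 1, by omega⟩
    have h1 := StarAlg.datumB_isCyclic (N := N)
    have h2 := StarAlg.datumB_isCyclicClass hN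
    subst hm
    refine StarAlg.nonempty_H_equiv h1 h2 (by push_cast; ring) 0 fun l hl q e h => ?_
    -- Again `j = -1` would force degree 1, whereas `m = N - 1 > 1`; this uses `2 < N`.
    have h' : StarAlg.Adm (StarAlg.datumB (m + 1)) m ((m : ℕ) + (-1)) l q e := by
      convert h using 1; push_cast; ring
    have := (StarAlg.datumB_adm hN (Or.inl rfl) hl h').1 rfl
    omega
  · exact hn ((StarAlg.datumB_adm hN (Or.inr rfl) hl h).2 rfl).1
  · exact hn ((StarAlg.datumB_adm hN (Or.inl rfl) hl h).1 rfl)
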